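/- Let $(G,+)$ be a finite abelian group. For $D\subseteq G$ put $D^{(-1)}=\{-x:x\in D\}$ and $\overline D=(G\setminus\{0\})\setminus D$, and write $D$ also for $\sum_{x\in D}x\in\mathbb Z[G]$. A family $B_1,\dots,B_\ell$ of subsets of $G$ is *symmetric* if $B_i=B_i^{(-1)}$ for all $i$. It is a *difference family* with index $\lambda$ if every nonzero element of $G$ occurs exactly $\lambda$ times among the differences $x-y$ ($x,y\in B_i$, $x\ne y$, $1\le i\le\ell$). A difference family is *of type $H_\ell^*$* ($\ell\in\{2,4,8\}$) if $\sum_i|B_i|-\ell(|G|+1)/4=\lambda$; for $\ell=4$ it is *of type $H$* if $\sum_i|B_i|-|G|=\lambda$. For a difference family $D_0,D_1,D_2,D_3$ of type $H$ consider the conditions (d1) $0\notin D_0\cup D_1\cup D_2\cup D_3$. (d2) There are $E_0,E_1\subseteq G\setminus\{0\}$ with $D_0+D_1-D_2-D_3=E_0-\overline{E}_0$ and $D_0+D_3-D_1-D_2=E_1-\overline{E}_1$ in $\mathbb Z[G]$ such that $E_0,E_1,\overline{E}_0,\overline{E}_1$ is a difference family of type $H_4^*$. (d3) $D_0D_2^{(-1)}+D_2D_0^{(-1)}+D_1D_3^{(-1)}+D_3D_1^{(-1)}=\bigl(\sum_{i}|D_i|-|G|+1\bigr)G$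 in $\mathbb Z[G]$. (d4) Every $x\ne0$ has coefficient $1$ or $3$ in $\sum_iD_i$; the coefficient of $0$ in $\sum_i D_i$ is even; and it is not the case that the coefficient of $0$ equals $2$ in exactly one of $D_0+D_1$, $D_2+D_3$, $D_0+D_3$, $D_1+D_2$. (d5) $|D_0|+|D_3|=|D_1|+|D_2|$. **Theorem.** Let $q=4m+1$ be a prime power. Then there is a symmetric difference family $D_0,D_1,D_2,D_3$ of type $H$ in $(\mathbb F_{q^2},+)$ satisfying (d1)–(d5). More precisely, let $\omega$ be any primitive element of $\mathbb F_{q^2}$ (a generator of $\mathbb F_{q^2}^\times$), put $C_i^{(N)}=\omega^i\langle\omega^N\rangle$ for $N\mid q^2-1$ and $i\in\mathbb Z$, and let $$D_0=\bigcup_{l=0}^{m-1}\bigcup_{u=1}^{3}C^{(8m+4)}_{4l+(2m+1)u}\ \cup\ \bigcup_{j=0}^{m}C^{(8m+4)}_{4j-2},\qquad D_i=\omega^{(2m+1)i}D_0\quad(i=1,2,3).$$ Then $D_0,D_1,D_2,D_3$ is such a family. Moreover, with $E_0=C^{(4)}_2\cup C^{(4)}_{2m+3}$ and $E_1=C^{(4)}_2\cup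 C^{(4)}_{2m+1}$, one has $\overline{E}_0=C^{(4)}_0\cup C^{(4)}_{2m+1}$, $\overline{E}_1=C^{(4)}_0\cup C^{(4)}_{2m+3}$, the signed sums are $D_0+D_1-D_2-D_3=E_0-\overline{E}_0$ and $D_0+D_3-D_1-D_2=E_1-\overline{E}_1$, and $E_0,E_1,\overline{E}_0,\overline{E}_1$ is a difference family of type $H_4^*$. -/

import Mathlib

noncomputable section

namespace DiffFam

open scoped AddMonoidAlgebra

section General

variable {G : Type*} [AddCommGroup G]

/-- The element `∑ x ∈ D, x` of the integral group ring `ℤ[G]`. -/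
def gs (D : Finset G) : ℤ[G] := ∑ x ∈ D, AddMonoidAlgebra.single x (1 : ℤ)

/-- `D^{(-1)} = {-x : x ∈ D}`. -/
def negSet (D : Finset G) : Finset G := D.map (Equiv.neg G).toEmbedding

variable [Fintype G]

/-- `G^* \ D`, where `G^*` is the set of nonzero elements. -/
def starCompl (D : Finset G) : Finset G :=
  open Classical in Finset.univ.filter (fun x => x ≠ 0 ∧ x ∉ D)

/-- Each block equals its own negative. -/
def IsSymmetric {ℓ : ℕ} (B : Fin ℓ → Finset G) : Prop := ∀ i, negSet (B i) = B i

/-- The number of triples `(i, x, y)` with `x, y ∈ B i`, `x ≠ y` and `x - y = g`. -/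
def diffCount {ℓ : ℕ} (B : Fin ℓ → Finset G) (g : G) : ℕ :=
  open Classical in
  ∑ i, ((B i ×ˢ B i).filter (fun p : G × G => p.1 ≠ p.2 ∧ p.1 - p.2 = g)).card

/-- The differences of distinct elements within blocks represent every nonzero element of `G`
exactly `lam` times. -/
def IsDifferenceFamily {ℓ : ℕ} (B : Fin ℓ → Finset G) (lam : ℕ) : Prop :=
  ∀ g : G, g ≠ 0 → diffCount B g = lam

/-- Difference families of type `H_ℓ^*`, `ℓ ∈ {2, 4, 8}`. -/
def IsTypeHStar {ℓ : ℕ} (B : Fin ℓ → Finset G) : Prop :=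
  (ℓ = 2 ∨ ℓ = 4 ∨ ℓ = 8) ∧
  ∃ lam : ℕ, IsDifferenceFamily B lam ∧
    (∑ i, ((B i).card : ℚ)) - ℓ * ((Fintype.card G : ℚ) + 1) / 4 = lam

/-- Difference families (with four blocks) of type `H`. -/
def IsTypeH (D : Fin 4 → Finset G) : Prop :=
  ∃ lam : ℕ, IsDifferenceFamily D lam ∧
    (∑ i, ((D i).card : ℤ)) - (Fintype.card G : ℤ) = lam

def CondD1 (D : Fin 4 → Finset G) : Prop := ∀ i, (0 : G) ∉ D i

def CondD2 (D : Fin 4 → Finset G) : Prop :=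
  ∃ E₀ E₁ : Finset G, (0 : G) ∉ E₀ ∧ (0 : G) ∉ E₁ ∧
    gs (D 0) + gs (D 1) - gs (D 2) - gs (D 3) = gs E₀ - gs (starCompl E₀) ∧
    gs (D 0) + gs (D 3) - gs (D 1) - gs (D 2) = gs E₁ - gs (starCompl E₁) ∧
    IsTypeHStar ![E₀, E₁, starCompl E₀, starCompl E₁]

def CondD3 (D : Fin 4 → Finset G) : Prop :=
  gs (D 0) * gs (negSet (D 2)) + gs (D 2) * gs (negSet (D 0))
      + gs (D 1) * gs (negSet (D 3)) + gs (D 3) * gs (negSet (D 1))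
    = ((∑ i, ((D i).card : ℤ)) - (Fintype.card G : ℤ) + 1) • gs (Finset.univ : Finset G)

/-- The four pair sums whose coefficients at `0` are inspected are `D 0 + D 1`, `D 1 + D 2`,
`D 2 + D 3` and `D 3 + D 0`, that is, `D p + D (p + 1)` with `p : Fin 4` read modulo 4. The
coefficient of `0` in the total sum is even, and it is not the case that the coefficient of `0`
equals two in exactly one of the four pair sums. -/
def CondD4 (D : Fin 4 → Finset G) : Prop :=
  (∀ x : G, x ≠ 0 → (∑ i, gs (D i)).coeff x = 1 ∨ (∑ i, gs (D i)).coeff x = 3) ∧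
  Even ((∑ i, gs (D i)).coeff 0) ∧
  ¬ ∃! p : Fin 4, (gs (D p) + gs (D (p + 1))).coeff 0 = 2

def CondD5 (D : Fin 4 → Finset G) : Prop :=
  (D 0).card + (D 3).card = (D 1).card + (D 2).card

/-- A symmetric difference family of type `H` satisfying (d1)-(d5). -/
def IsGoodFamily (D : Fin 4 → Finset G) : Prop :=
  IsSymmetric D ∧ IsTypeH D ∧ CondD1 D ∧ CondD2 D ∧ CondD3 D ∧ CondD4 D ∧ CondD5 D

end General

section Cyclotomy

variable {F : Type*} [Field F] [Fintype F]

/-- The cyclotomic class `ω^i ⟨ω^N⟩`. -/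
def cycClass (ω : Fˣ) (N : ℕ) (i : ℤ) : Finset F :=
  open Classical in
  Finset.univ.filter (fun x => ∃ h ∈ Subgroup.zpowers (ω ^ N), x = ((ω ^ i * h : Fˣ) : F))

/-- The base block `D₀`: the union of the classes of order `8m+4` with index `4l + (2m+1)u`
(`0 ≤ l ≤ m-1`, `1 ≤ u ≤ 3`) and those with index `4j - 2` (`0 ≤ j ≤ m`). -/
def baseBlock (ω : Fˣ) (m : ℕ) : Finset F :=
  open Classical in
  ((Finset.range m).biUnion fun l => (Finset.Icc 1 3).biUnion fun u =>
      cycClass ω (8 * m + 4) (4 * (l : ℤ) + (2 * (m : ℤ) + 1) * ((u : ℕ) : ℤ))) ∪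
    (Finset.range (m + 1)).biUnion fun j => cycClass ω (8 * m + 4) (4 * (j : ℤ) - 2)

/-- The family `D_i = ω^{(2m+1)i} D₀`, `i = 0, 1, 2, 3`. -/
def cycFamily (ω : Fˣ) (m : ℕ) (i : Fin 4) : Finset F :=
  (baseBlock ω m).map (Units.mulLeft (ω ^ ((2 * m + 1) * (i : ℕ)))).toEmbedding

/-- `C_a ∪ C_b` for the cyclotomic classes of order four. -/
def quarticPair (ω : Fˣ) (a b : ℕ) : Finset F :=
  open Classical in cycClass ω 4 (a : ℤ) ∪ cycClass ω 4 (b : ℤ)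

end Cyclotomy

end DiffFam

end

/-!
The construction lives in the group ring `ℤ[F]`, where `F` has `q²` elements and `q = 4 m + 1`.
Write `N` for the sum of all elements of `F`, and call the `q + 1` one-dimensional subspaces over the
subfield with `q` elements *lines*. A class `C_i` of order `8 m + 4 = 2 (q + 1)` is one half of a
line without `0`: the nonzero squares of the subfield times `ω ^ i`. The other half is
`C_{i + 4 m + 2}`.

Sorting exponents by their residue modulo `4`, the base block consists of some full lines with odd
exponent, without `0`, together with the whole quartic class `C₂`, which contains one half of every line with
even exponent (`two_mul_baseIndex`). Hence `2 D_i = P_i - Y_i` (`two_mul_gs_cycFamily`), where `P_i`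
is an integer combination of lines minus `q`, and `Y_i` is the difference of two opposite quartic
classes. Since `P_{i+2} = P_i` and `Y_{i+2} = -Y_i`, every assertion about the sums and products of
the blocks reduces to two identities.

* `P₀² + P₁² = q² + (2 q² - 4 q + 1) N` (`linePart_sq_add_sq`). A line times itself is `q` times
  the line, two distinct lines have product `N`, and the sum of all lines is `N + q`. The coefficients
  `w₀`, `w₁` of a given line in `P₀`, `P₁` satisfy `(w₀ - 1)² + (w₁ - 1)² = 1`, so that the lines
  occur in the sum of the squares with one common coefficient.
* `Y₀² + Y₁² = q² - N` (`quarticElement_sq_add_sq`). Here `Y₀` and `Y₁` are, up to sign, the real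
  and imaginary parts of the quartic residue character `χ`, so the coefficient of `g` on the left is the
  sum of `Re χ(x / (g - x))` over `x`. For `g ≠ 0` the argument runs once through all elements
  except `-1`, and `χ(-1) = 1`.

Adding the identities gives the type `H` condition, subtracting them gives `CondD3`. The family
`E₀, E₁` and its complements involve only the second identity, because `E₀ - E̅₀ = -Y₀ - Y₁` and
`E₁ - E̅₁ = Y₁ - Y₀`.
-/

noncomputable section

namespace DiffFam

open scoped AddMonoidAlgebra

/-! ### Products in the group ring -/

section GroupRing

open Classical in
theorem coeff_gs {G : Type*} (D : Finset G) (x : G) : (gs D).coeff x = if x ∈ D then 1 else 0 := by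
  simp [gs, AddMonoidAlgebra.coeff_sum, AddMonoidAlgebra.coeff_single, Finsupp.single_apply]

variable {G : Type*} [AddCommGroup G]

theorem mul_left_cancel_intCast {k : ℤ} (hk : k ≠ 0) {a b : ℤ[G]}
    (h : (k : ℤ[G]) * a = (k : ℤ[G]) * b) : a = b := by
  ext x
  have h' := congrArg (fun c : ℤ[G] => c.coeff x) h
  simp only [← zsmul_eq_mul, AddMonoidAlgebra.coeff_smul_apply, smul_eq_mul] at h'
  exact mul_left_cancel₀ hk h'

theorem gs_mul_gs (A B : Finset G) :
    gs A * gs B = ∑ p ∈ A ×ˢ B, AddMonoidAlgebra.single (p.1 + p.2) (1 : ℤ) := by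
  simp [gs, Finset.sum_mul_sum, Finset.sum_product, AddMonoidAlgebra.single_mul_single]

/-- The product of two complementary blocks, such as two distinct lines of a plane. -/
theorem gs_mul_gs_eq_univ [Fintype G] {A B : Finset G}
    (hinj : ∀ a ∈ A, ∀ b ∈ B, ∀ a' ∈ A, ∀ b' ∈ B, a + b = a' + b' → a = a' ∧ b = b')
    (hcard : A.card * B.card = Fintype.card G) :
    gs A * gs B = gs (Finset.univ : Finset G) := by
  classical
  have hI : Set.InjOn (fun p : G × G => p.1 + p.2) (A ×ˢ B : Finset (G × G)) := by
    rintro ⟨a, b⟩ h ⟨a', b'⟩ h' e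
    simp only [Finset.coe_product, Set.mem_prod, Finset.mem_coe] at h h'
    obtain ⟨h1, h2⟩ := hinj a h.1 b h.2 a' h'.1 b' h'.2 e
    rw [h1, h2]
  have himg : (A ×ˢ B).image (fun p : G × G => p.1 + p.2) = Finset.univ := by
    rw [← Finset.card_eq_iff_eq_univ, Finset.card_image_of_injOn hI, Finset.card_product, hcard]
  rw [gs_mul_gs, gs, ← himg, Finset.sum_image hI]

/-- If `B` is invariant under translation by `±a` for every `a ∈ A`, then `A B = |A| B`. This covers
the square of a subgroup and products with the whole group. -/
theorem gs_mul_gs_of_translate {A B : Finset G}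
    (hadd : ∀ a ∈ A, ∀ b ∈ B, a + b ∈ B) (hsub : ∀ a ∈ A, ∀ b ∈ B, b - a ∈ B) :
    gs A * gs B = (A.card : ℤ[G]) * gs B := by
  rw [gs_mul_gs, Finset.sum_product, ← nsmul_eq_mul, ← Finset.sum_const]
  refine Finset.sum_congr rfl fun a ha => ?_
  refine Finset.sum_nbij' (fun b => a + b) (fun b => b - a) (fun b hb => hadd a ha b hb)
    (fun b hb => hsub a ha b hb) ?_ ?_ ?_ <;> simp

theorem gs_mul_univ [Fintype G] (A : Finset G) :
    gs A * gs (Finset.univ : Finset G) = (A.card : ℤ[G]) * gs (Finset.univ : Finset G) :=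
  gs_mul_gs_of_translate (by simp) (by simp)

theorem univ_mul_univ [Fintype G] :
    gs (Finset.univ : Finset G) * gs (Finset.univ : Finset G)
      = (Fintype.card G : ℤ[G]) * gs (Finset.univ : Finset G) :=
  gs_mul_univ _

theorem coeff_mul_eq_sum [Fintype G] (a b : ℤ[G]) (g : G) :
    (a * b).coeff g = ∑ x, a.coeff x * b.coeff (g - x) := by
  classical
  rw [AddMonoidAlgebra.coeff_mul_antidiag a b g
    (Finset.univ.image fun x : G => (x, g - x)), Finset.sum_image]
  · intro x _ y _ h
    exact (Prod.ext_iff.mp h).1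
  · rintro ⟨x, y⟩
    simp only [Finset.mem_image, Finset.mem_univ, true_and, Prod.mk.injEq]
    constructor
    · rintro ⟨_, rfl, rfl⟩
      abel
    · rintro rfl
      exact ⟨x, rfl, by abel⟩

/-- The augmentation `ℤ[G] → ℤ`, the sum of the coefficients. -/
def aug : ℤ[G] →ₐ[ℤ] ℤ := AddMonoidAlgebra.lift ℤ ℤ G 1

theorem aug_gs (D : Finset G) : aug (gs D) = D.card := by
  simp [aug, gs]

theorem negSet_eq_self {D : Finset G} (h : ∀ x ∈ D, -x ∈ D) : negSet D = D := by
  ext x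
  simp only [negSet, Finset.mem_map, Equiv.coe_toEmbedding, Equiv.neg_apply]
  constructor
  · rintro ⟨y, hy, rfl⟩
    exact h y hy
  · exact fun hx => ⟨-x, h x hx, neg_neg x⟩

theorem neg_mem_of_negSet_eq {D : Finset G} (h : negSet D = D) {x : G} (hx : x ∈ D) : -x ∈ D := by
  rw [← h]
  exact Finset.mem_map_of_mem _ hx

/-- For symmetric blocks, the differences are the coefficients of the sum of the squares. -/
theorem diffCount_eq_coeff {ℓ : ℕ} {B : Fin ℓ → Finset G} (hB : IsSymmetric B) {g : G}
    (hg : g ≠ 0) : (diffCount B g : ℤ) = (∑ i, gs (B i) * gs (B i)).coeff g := by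
  classical
  rw [diffCount, AddMonoidAlgebra.coeff_sum, Finsupp.finsetSum_apply, Nat.cast_sum]
  refine Finset.sum_congr rfl fun i _ => ?_
  rw [gs_mul_gs, AddMonoidAlgebra.coeff_sum, Finsupp.finsetSum_apply]
  simp only [AddMonoidAlgebra.coeff_single, Finsupp.single_apply]
  rw [Finset.sum_boole]
  congr 1
  refine Finset.card_nbij' (fun p => (p.1, -p.2)) (fun p => (p.1, -p.2)) ?_ ?_ ?_ ?_
  · rintro ⟨x, y⟩ h
    simp only [Finset.coe_filter, Finset.mem_product, Set.mem_ofPred_eq] at h ⊢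
    exact ⟨⟨h.1.1, neg_mem_of_negSet_eq (hB i) h.1.2⟩, by rw [← sub_eq_add_neg]; exact h.2.2⟩
  · rintro ⟨x, y⟩ h
    simp only [Finset.coe_filter, Finset.mem_product, Set.mem_ofPred_eq] at h ⊢
    refine ⟨⟨h.1.1, neg_mem_of_negSet_eq (hB i) h.1.2⟩, ?_, by rw [sub_neg_eq_add]; exact h.2⟩
    rintro rfl
    exact hg (by rw [← h.2]; abel)
  · intro p _
    simp
  · intro p _
    simp

theorem gs_add_gs_starCompl [Fintype G] {E : Finset G}
    (hE : (0 : G) ∉ E) : gs E + gs (starCompl E) = gs (Finset.univ : Finset G) - 1 := by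
  classical
  ext x
  simp only [AddMonoidAlgebra.coeff_add, AddMonoidAlgebra.coeff_sub, Finsupp.add_apply,
    Finsupp.sub_apply, coeff_gs, AddMonoidAlgebra.one_def, AddMonoidAlgebra.coeff_single,
    Finsupp.single_apply, starCompl, Finset.mem_filter, Finset.mem_univ, true_and, if_true]
  by_cases h0 : x = 0
  · simp [h0, hE]
  · by_cases hx : x ∈ E <;> simp [h0, Ne.symm h0, hx]

end GroupRing

/-! ### Exponents of the base block -/

/-- A function of period `M` is recovered from its values on `0, …, M - 1`. -/
theorem sum_range_mul_ite_dvd {M : ℕ} (hM : 0 < M) {f : ℤ → ℤ}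
    (hf : ∀ a b : ℤ, (M : ℤ) ∣ a - b → f a = f b) (n : ℤ) :
    ∑ j ∈ Finset.range M, f j * (if (M : ℤ) ∣ n - j then 1 else 0) = f n := by
  have hM' : (0 : ℤ) < M := by exact_mod_cast hM
  have h0 := Int.emod_nonneg n hM'.ne'
  have h1 := Int.emod_lt_of_pos n hM'
  have hcast : (((n % (M : ℤ)).toNat : ℕ) : ℤ) = n % M := Int.toNat_of_nonneg h0
  have hdvd : (M : ℤ) ∣ n - n % M := Int.dvd_self_sub_emod
  rw [Finset.sum_eq_single (n % (M : ℤ)).toNat]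
  · rw [hcast, if_pos hdvd, mul_one]
    exact (hf _ _ hdvd).symm
  · intro j hj hne
    rw [if_neg, mul_zero]
    intro hd
    apply hne
    have hj' : (j : ℤ) < M := by exact_mod_cast Finset.mem_range.mp hj
    have : (j : ℤ) % M = n % M := Int.modEq_iff_dvd.mpr hd
    rw [Int.emod_eq_of_lt (Int.natCast_nonneg j) hj'] at this
    omega
  · intro h
    exact absurd (Finset.mem_range.mpr (by omega)) h

theorem sum_range_ite_dvd {M : ℕ} (hM : 0 < M) (n : ℤ) :
    ∑ j ∈ Finset.range M, (if (M : ℤ) ∣ n - j then (1 : ℤ) else 0) = 1 := by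
  simpa using sum_range_mul_ite_dvd hM (f := fun _ => 1) (fun _ _ _ => rfl) n

theorem sum_range_ite_dvd_comp {M k : ℕ} {g : ℕ → ℤ}
    (hg : ∀ i < k, ∀ j < k, (M : ℤ) ∣ g i - g j → i = j) (n : ℤ)
    [Decidable (∃ l < k, (M : ℤ) ∣ n - g l)] :
    ∑ l ∈ Finset.range k, (if (M : ℤ) ∣ n - g l then (1 : ℤ) else 0)
      = if ∃ l < k, (M : ℤ) ∣ n - g l then 1 else 0 := by
  split_ifs with h
  · obtain ⟨l, hl, hd⟩ := h
    rw [Finset.sum_eq_single l, if_pos hd]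
    · intro j hj hne
      refine if_neg fun hd' => hne ?_
      refine hg j (Finset.mem_range.mp hj) l hl ?_
      have := dvd_sub hd hd'
      rwa [sub_sub_sub_cancel_left] at this
    · exact fun h => absurd (Finset.mem_range.mpr hl) h
  · exact Finset.sum_eq_zero fun l hl => if_neg fun hd => h ⟨l, Finset.mem_range.mp hl, hd⟩

/-- The exponents `n` (modulo `8 m + 4`) for which `ω ^ n` lies in the base block. -/
def BaseIndex (m : ℕ) (n : ℤ) : Prop :=
  (∃ l < m, ∃ u : ℕ, (1 ≤ u ∧ u ≤ 3) ∧
      ((8 * m + 4 : ℕ) : ℤ) ∣ n - (4 * (l : ℤ) + (2 * (m : ℤ) + 1) * (u : ℤ))) ∨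
    ∃ j < m + 1, ((8 * m + 4 : ℕ) : ℤ) ∣ n - (4 * (j : ℤ) - 2)

/-- The odd exponents of the lines through `0` whose nonzero elements all lie in the base block. -/
def FullLineIndex (m : ℕ) (n : ℤ) : Prop :=
  ∃ l < m, ((4 * m + 2 : ℕ) : ℤ) ∣ n - (4 * (l : ℤ) + (2 * (m : ℤ) + 1))

open Classical in
/-- The number of halves of the line through `0` and `ω ^ n` contained in the base block. -/
def lineWeight (m : ℕ) (n : ℤ) : ℤ :=
  if n % 2 = 0 then 1 else if FullLineIndex m n then 2 else 0

/-- The real part of `i ^ n`. -/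
def quarticSign (n : ℤ) : ℤ := if n % 4 = 0 then 1 else if n % 4 = 2 then -1 else 0

/-- The structure of the base block: for odd `n`, the nonzero elements of the lines through `ω ^ n`
with `FullLineIndex m n`; for even `n`, the whole class `C₂` of order four. -/
theorem two_mul_baseIndex (m : ℕ) (n : ℤ) [Decidable (BaseIndex m n)] :
    2 * (if BaseIndex m n then (1 : ℤ) else 0) = lineWeight m n - quarticSign n := by
  have h4 : (4 : ℤ) ∣ ((8 * m + 4 : ℕ) : ℤ) := ⟨2 * m + 1, by push_cast; ring⟩
  have hm : (4 * m + 2 : ℕ) ∣ (8 * m + 4 : ℕ) := ⟨2, by ring⟩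
  rcases Int.emod_two_eq_zero_or_one n with h2 | h2
  · have hw : lineWeight m n = 1 := if_pos h2
    have h : n % 4 = 0 ∨ n % 4 = 2 := by omega
    rcases h with h | h
    · have hI : ¬ BaseIndex m n := by
        rintro (⟨l, -, u, ⟨hu, hu'⟩, hd⟩ | ⟨j, -, hd⟩)
        · have := h4.trans hd
          interval_cases u <;> omega
        · have := h4.trans hd
          omega
      rw [if_neg hI, hw, quarticSign, if_pos h]
      rfl
    · have hI : BaseIndex m n := by
        -- the class of index `4 r - 2` is a `j`-class if `r ≤ m`, otherwise a class with `u = 2`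
        obtain ⟨t, ht⟩ : ∃ t : ℤ, n = 4 * t - 2 := ⟨(n + 2) / 4, by omega⟩
        have hpos : (0 : ℤ) < 2 * m + 1 := by omega
        have h0 := Int.emod_nonneg t hpos.ne'
        have h1 := Int.emod_lt_of_pos t hpos
        have hdm := Int.mul_ediv_add_emod t (2 * m + 1)
        generalize t % (2 * m + 1) = r at *
        generalize t / (2 * m + 1) = k at *
        by_cases hr : r ≤ m
        · refine Or.inr ⟨r.toNat, by omega, k, ?_⟩
          rw [Int.toNat_of_nonneg h0, ht, ← hdm]
          push_cast
          ring
        · refine Or.inl ⟨(r - m - 1).toNat, by omega, 2, by omega, k, ?_⟩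
          rw [Int.toNat_of_nonneg (by omega), ht, ← hdm]
          push_cast
          ring
      rw [if_pos hI, hw, quarticSign, if_neg (by omega), if_pos h]
      rfl
  · have hiff : BaseIndex m n ↔ FullLineIndex m n := by
      constructor
      · rintro (⟨l, hl, u, ⟨hu, hu'⟩, hd⟩ | ⟨j, -, hd⟩)
        · have hd4 := h4.trans hd
          have hdm := (Int.natCast_dvd_natCast.mpr hm).trans hd
          refine ⟨l, hl, ?_⟩
          interval_cases u
          · simpa using hdm
          · omega
          · obtain ⟨k, hk⟩ := hdm
            push_cast at hk
            exact ⟨k + 1, by push_cast; linear_combination hk⟩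
        · have := h4.trans hd
          omega
      · rintro ⟨l, hl, k, hk⟩
        push_cast at hk
        obtain ⟨t, rfl | rfl⟩ := Int.even_or_odd' k
        · exact Or.inl ⟨l, hl, 1, by omega, t, by push_cast; linear_combination hk⟩
        · exact Or.inl ⟨l, hl, 3, by omega, t, by push_cast; linear_combination hk⟩
    have h0 : quarticSign n = 0 := by
      rw [quarticSign, if_neg (by omega), if_neg (by omega)]
    have h2' : ¬ n % 2 = 0 := by omega
    rw [h0, lineWeight, if_neg h2']
    by_cases h : FullLineIndex m n
    · rw [if_pos h, if_pos (hiff.mpr h)]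
      rfl
    · rw [if_neg h, if_neg (mt hiff.mp h)]
      rfl

theorem BaseIndex.congr {m : ℕ} {a b : ℤ} (h : ((8 * m + 4 : ℕ) : ℤ) ∣ a - b)
    (hb : BaseIndex m b) : BaseIndex m a := by
  rcases hb with ⟨l, hl, u, hu, hd⟩ | ⟨j, hj, hd⟩
  · exact Or.inl ⟨l, hl, u, hu, by simpa only [sub_add_sub_cancel] using dvd_add h hd⟩
  · exact Or.inr ⟨j, hj, by simpa only [sub_add_sub_cancel] using dvd_add h hd⟩

theorem FullLineIndex.congr {m : ℕ} {a b : ℤ} (h : ((4 * m + 2 : ℕ) : ℤ) ∣ a - b)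
    (hb : FullLineIndex m b) : FullLineIndex m a := by
  obtain ⟨l, hl, hd⟩ := hb
  exact ⟨l, hl, by simpa only [sub_add_sub_cancel] using dvd_add h hd⟩

theorem lineWeight_congr {m : ℕ} {a b : ℤ} (h : ((4 * m + 2 : ℕ) : ℤ) ∣ a - b) :
    lineWeight m a = lineWeight m b := by
  have h2 : (2 : ℤ) ∣ a - b := dvd_trans ⟨2 * m + 1, by push_cast; ring⟩ h
  have hiff : FullLineIndex m a ↔ FullLineIndex m b :=
    ⟨fun ha => ha.congr (by rwa [dvd_sub_comm]), fun hb => hb.congr h⟩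
  have hpar : a % 2 = 0 ↔ b % 2 = 0 := by omega
  unfold lineWeight
  split_ifs <;> tauto

/-- Of two lines whose exponents differ by `2 m + 1`, one is met in exactly one half and the other
in none or both; this is what makes the squares of the line parts add up. -/
theorem lineWeight_shift (m : ℕ) (n : ℤ) :
    (lineWeight m n - 1) ^ 2 + (lineWeight m (n - (2 * m + 1)) - 1) ^ 2 = 1 := by
  unfold lineWeight
  rcases Int.emod_two_eq_zero_or_one n with h | h
  · rw [if_pos h, if_neg (by omega)]
    split_ifs <;> norm_num
  · rw [if_neg (by omega), if_pos (by omega : (n - (2 * m + 1)) % 2 = 0)]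
    split_ifs <;> norm_num

theorem lineWeight_add_shift (m : ℕ) (n : ℤ) :
    lineWeight m n + lineWeight m (n - (2 * m + 1)) = 1 ∨
      lineWeight m n + lineWeight m (n - (2 * m + 1)) = 3 := by
  unfold lineWeight
  rcases Int.emod_two_eq_zero_or_one n with h | h
  · rw [if_pos h, if_neg (by omega)]
    split_ifs <;> norm_num
  · rw [if_neg (by omega), if_pos (by omega : (n - (2 * m + 1)) % 2 = 0)]
    split_ifs <;> norm_num

theorem lineWeight_eq_sum (m : ℕ) (n : ℤ) :
    lineWeight m n =
      ∑ r ∈ Finset.range (2 * m + 1),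
          (if ((4 * m + 2 : ℕ) : ℤ) ∣ n - 2 * (r : ℤ) then (1 : ℤ) else 0) +
        2 * ∑ l ∈ Finset.range m,
          (if ((4 * m + 2 : ℕ) : ℤ) ∣ n - (4 * (l : ℤ) + (2 * (m : ℤ) + 1))
            then (1 : ℤ) else 0) := by
  classical
  have h2 : (2 : ℤ) ∣ ((4 * m + 2 : ℕ) : ℤ) := ⟨2 * m + 1, by push_cast; ring⟩
  have hsmall : ∀ z : ℤ, ((4 * m + 2 : ℕ) : ℤ) ∣ z → |z| < ((4 * m + 2 : ℕ) : ℤ) → z = 0 :=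
    fun z => Int.eq_zero_of_abs_lt_dvd
  rw [sum_range_ite_dvd_comp (g := fun r => 2 * (r : ℤ)),
    sum_range_ite_dvd_comp (g := fun l => 4 * (l : ℤ) + (2 * (m : ℤ) + 1))]
  · have he : (∃ r < 2 * m + 1, ((4 * m + 2 : ℕ) : ℤ) ∣ n - 2 * (r : ℤ)) ↔ n % 2 = 0 := by
      constructor
      · rintro ⟨r, -, hd⟩
        have := h2.trans hd
        omega
      · intro h
        have hpos : (0 : ℤ) < 2 * m + 1 := by omega
        have h0 := Int.emod_nonneg (n / 2) hpos.ne'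
        have h1 := Int.emod_lt_of_pos (n / 2) hpos
        have hdm := Int.mul_ediv_add_emod (n / 2) (2 * m + 1)
        refine ⟨(n / 2 % (2 * m + 1)).toNat, by omega, n / 2 / (2 * m + 1), ?_⟩
        rw [Int.toNat_of_nonneg h0]
        have : n = 2 * (n / 2) := by omega
        push_cast
        linear_combination this - 2 * hdm
    have ho : (∃ l < m, ((4 * m + 2 : ℕ) : ℤ) ∣ n - (4 * (l : ℤ) + (2 * (m : ℤ) + 1))) →
        ¬ n % 2 = 0 := by
      rintro ⟨l, -, hd⟩
      have := h2.trans hd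
      omega
    simp only [he, lineWeight]
    by_cases h : n % 2 = 0
    · rw [if_pos h, if_pos h, if_neg (fun h' => ho h' h)]
      rfl
    · rw [if_neg h, if_neg h]
      unfold FullLineIndex
      split_ifs <;> rfl
  · intro i hi j hj hd
    have := hsmall _ hd (by rw [abs_lt]; push_cast; omega)
    omega
  · intro i hi j hj hd
    have := hsmall _ hd (by rw [abs_lt]; push_cast; omega)
    omega

/-- The base block, and each of its multiples, is a union of `q = 4 m + 1` half-lines. -/
theorem sum_lineWeight (m : ℕ) (s : ℤ) :
    ∑ j ∈ Finset.range (4 * m + 2), lineWeight m ((j : ℤ) - s) = 4 * m + 1 := by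
  have key : ∀ t : ℤ, ∑ j ∈ Finset.range (4 * m + 2),
      (if ((4 * m + 2 : ℕ) : ℤ) ∣ (j : ℤ) - s - t then (1 : ℤ) else 0) = 1 := by
    intro t
    refine Eq.trans (Finset.sum_congr rfl fun j _ => ?_)
      (sum_range_ite_dvd (M := 4 * m + 2) (by omega) (s + t))
    simp only [sub_sub, dvd_sub_comm (b := (j : ℤ))]
  simp only [lineWeight_eq_sum, Finset.sum_add_distrib, ← Finset.mul_sum]
  rw [Finset.sum_comm, Finset.sum_comm (s := Finset.range (4 * m + 2)) (t := Finset.range m)]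
  simp only [key]
  simp
  ring

/-- With `i ^ (2 m + 1) = ± i`, the left-hand side is `Re (i ^ a * conj (i ^ b))`. -/
theorem quarticSign_mul_add (m : ℕ) (a b : ℤ) :
    quarticSign a * quarticSign b
      + quarticSign (a - (2 * m + 1)) * quarticSign (b - (2 * m + 1)) = quarticSign (a - b) := by
  have hz : ∀ z : ℤ, z % 4 = 0 ∧ quarticSign z = 1 ∨ z % 4 = 2 ∧ quarticSign z = -1 ∨
      z % 2 = 1 ∧ quarticSign z = 0 := by
    intro z
    unfold quarticSign
    split_ifs <;> omega
  rcases hz a with ⟨ha, ea⟩ | ⟨ha, ea⟩ | ⟨ha, ea⟩ <;>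
  rcases hz b with ⟨hb, eb⟩ | ⟨hb, eb⟩ | ⟨hb, eb⟩ <;>
  rcases hz (a - (2 * m + 1)) with ⟨hc, ec⟩ | ⟨hc, ec⟩ | ⟨hc, ec⟩ <;>
  rcases hz (b - (2 * m + 1)) with ⟨hd, ed⟩ | ⟨hd, ed⟩ | ⟨hd, ed⟩ <;>
  rcases hz (a - b) with ⟨he, ee⟩ | ⟨he, ee⟩ | ⟨he, ee⟩ <;>
  first
    | omega
    | simp only [ea, eb, ec, ed, ee]; norm_num

theorem quarticSign_add_two (n : ℤ) : quarticSign (n + 2) = -quarticSign n := by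
  unfold quarticSign
  split_ifs <;> omega

/-! ### Powers of a primitive element -/

section Field

variable {F : Type*} [Field F] [Fintype F]

theorem exists_zpow_of_ne_zero {F : Type*} [Field F] {ω : Fˣ}
    (hω : ∀ x : Fˣ, x ∈ Subgroup.zpowers ω) {x : F}
    (hx : x ≠ 0) : ∃ n : ℤ, x = ((ω ^ n : Fˣ) : F) := by
  obtain ⟨n, hn⟩ := hω (Units.mk0 x hx)
  exact ⟨n, by rw [show ω ^ n = Units.mk0 x hx from hn, Units.val_mk0]⟩

theorem zpow_eq_zpow_iff_dvd {m : ℕ} (hF : Fintype.card F = (4 * m + 1) ^ 2) {ω : Fˣ}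
    (hω : ∀ x : Fˣ, x ∈ Subgroup.zpowers ω) (a b : ℤ) :
    ((ω ^ a : Fˣ) : F) = ((ω ^ b : Fˣ) : F) ↔ ((2 * m * (8 * m + 4) : ℕ) : ℤ) ∣ a - b := by
  have ho : orderOf ω = 2 * m * (8 * m + 4) := by
    classical
    rw [orderOf_eq_card_of_forall_mem_zpowers hω, Nat.card_eq_fintype_card, Fintype.card_units, hF,
      Nat.sub_eq_iff_eq_add (Nat.one_le_pow _ _ (by omega))]
    ring
  rw [Units.val_inj, ← ho, orderOf_dvd_sub_iff_zpow_eq_zpow]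

theorem exists_neg_one_eq_zpow {m : ℕ} (hF : Fintype.card F = (4 * m + 1) ^ 2) {ω : Fˣ}
    (hω : ∀ x : Fˣ, x ∈ Subgroup.zpowers ω) :
    ∃ t : ℤ, (-1 : F) = ((ω ^ t : Fˣ) : F) ∧ ((8 * m + 4 : ℕ) : ℤ) ∣ t := by
  obtain ⟨t, ht⟩ := exists_zpow_of_ne_zero hω (neg_ne_zero.mpr one_ne_zero : (-1 : F) ≠ 0)
  refine ⟨t, ht, ?_⟩
  have h : ((ω ^ (2 * t) : Fˣ) : F) = ((ω ^ (0 : ℤ) : Fˣ) : F) := by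
    rw [mul_comm, zpow_mul, zpow_zero, Units.val_one, zpow_ofNat, Units.val_pow_eq_pow_val, ← ht]
    norm_num
  obtain ⟨k, hk⟩ := (zpow_eq_zpow_iff_dvd hF hω _ _).mp h
  push_cast at hk
  refine ⟨m * k, mul_left_cancel₀ (two_ne_zero (α := ℤ)) ?_⟩
  push_cast
  linear_combination hk

theorem zero_notMem_cycClass (ω : Fˣ) (N : ℕ) (i : ℤ) : (0 : F) ∉ cycClass ω N i := by
  simp only [cycClass, Finset.mem_filter, not_and, not_exists]
  exact fun _ h _ e => (Units.ne_zero _ e.symm)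

theorem zpow_mem_cycClass {m : ℕ} (hF : Fintype.card F = (4 * m + 1) ^ 2) {ω : Fˣ}
    (hω : ∀ x : Fˣ, x ∈ Subgroup.zpowers ω) {N : ℕ} (hN : N ∣ 8 * m + 4) (n i : ℤ) :
    ((ω ^ n : Fˣ) : F) ∈ cycClass ω N i ↔ (N : ℤ) ∣ n - i := by
  have hN' : (N : ℤ) ∣ ((2 * m * (8 * m + 4) : ℕ) : ℤ) :=
    Int.natCast_dvd_natCast.mpr (hN.mul_left _)
  simp only [cycClass, Finset.mem_filter, Finset.mem_univ, true_and]
  constructor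
  · rintro ⟨_, ⟨k, rfl⟩, h⟩
    have h' : ((ω ^ n : Fˣ) : F) = ((ω ^ (i + N * k) : Fˣ) : F) := by
      rw [h, zpow_add, zpow_mul, zpow_natCast]
    have hd := hN'.trans ((zpow_eq_zpow_iff_dvd hF hω _ _).mp h')
    have := dvd_add hd (dvd_mul_right (N : ℤ) k)
    rwa [show n - (i + N * k) + N * k = n - i by ring] at this
  · rintro ⟨k, hk⟩
    refine ⟨(ω ^ N) ^ k, ⟨k, rfl⟩, ?_⟩
    rw [← zpow_natCast, ← zpow_mul, ← zpow_add, ← hk, add_sub_cancel]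

/-- Elements of `ℤ[F]` may be compared at `0` and at the powers of a primitive element. -/
theorem groupRing_ext {F : Type*} [Field F] {ω : Fˣ}
    (hω : ∀ x : Fˣ, x ∈ Subgroup.zpowers ω) {a b : ℤ[F]}
    (h0 : a.coeff 0 = b.coeff 0)
    (h : ∀ n : ℤ, a.coeff ((ω ^ n : Fˣ) : F) = b.coeff ((ω ^ n : Fˣ) : F)) : a = b := by
  ext x
  by_cases hx : x = 0
  · rw [hx, h0]
  · obtain ⟨n, rfl⟩ := exists_zpow_of_ne_zero hω hx
    exact h n

theorem finset_ext_zpow {F : Type*} [Field F] {ω : Fˣ}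
    (hω : ∀ x : Fˣ, x ∈ Subgroup.zpowers ω) {A B : Finset F}
    (hA : 0 ∉ A) (hB : 0 ∉ B)
    (h : ∀ n : ℤ, ((ω ^ n : Fˣ) : F) ∈ A ↔ ((ω ^ n : Fˣ) : F) ∈ B) : A = B := by
  ext x
  by_cases hx : x = 0
  · simp [hx, hA, hB]
  · obtain ⟨n, rfl⟩ := exists_zpow_of_ne_zero hω hx
    exact h n

/-! ### The quartic classes -/

/-- The signed sum `C_s - C_{s+2}` of two opposite cyclotomic classes of order four. -/
def quarticElement (ω : Fˣ) (s : ℤ) : ℤ[F] := gs (cycClass ω 4 s) - gs (cycClass ω 4 (s + 2))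

theorem coeff_quarticElement_zero (ω : Fˣ) (s : ℤ) : (quarticElement ω s).coeff 0 = 0 := by
  simp [quarticElement, coeff_gs, zero_notMem_cycClass]

theorem coeff_quarticElement_zpow {m : ℕ} (hF : Fintype.card F = (4 * m + 1) ^ 2) {ω : Fˣ}
    (hω : ∀ x : Fˣ, x ∈ Subgroup.zpowers ω) (s n : ℤ) :
    (quarticElement ω s).coeff ((ω ^ n : Fˣ) : F) = quarticSign (n - s) := by
  have h4 : 4 ∣ 8 * m + 4 := ⟨2 * m + 1, by ring⟩
  simp only [quarticElement, AddMonoidAlgebra.coeff_sub, Finsupp.sub_apply, coeff_gs,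
    zpow_mem_cycClass hF hω h4, quarticSign, Nat.cast_ofNat]
  split_ifs <;> first | rfl | omega

theorem quarticElement_add_two {m : ℕ} (hF : Fintype.card F = (4 * m + 1) ^ 2) {ω : Fˣ}
    (hω : ∀ x : Fˣ, x ∈ Subgroup.zpowers ω) (s : ℤ) {t : ℤ} (ht : t % 4 = 2) :
    quarticElement ω (s + t) = -quarticElement ω s := by
  refine groupRing_ext hω ?_ fun n => ?_
  · simp [coeff_quarticElement_zero]
  · simp only [AddMonoidAlgebra.coeff_neg, Finsupp.neg_apply, coeff_quarticElement_zpow hF hω,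
      quarticSign]
    split_ifs <;> omega

/-- The quartic residue character is multiplicative: `Re (χ x * conj (χ z)) = Re (χ (x / z))`. -/
theorem coeff_quarticElement_div {m : ℕ} (hF : Fintype.card F = (4 * m + 1) ^ 2) {ω : Fˣ}
    (hω : ∀ x : Fˣ, x ∈ Subgroup.zpowers ω) (x z : F) :
    (quarticElement ω 0).coeff x * (quarticElement ω 0).coeff z
      + (quarticElement ω (2 * m + 1)).coeff x * (quarticElement ω (2 * m + 1)).coeff z
      = (quarticElement ω 0).coeff (x / z) := by
  by_cases hx : x = 0
  · simp [hx, coeff_quarticElement_zero]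
  by_cases hz : z = 0
  · simp [hz, coeff_quarticElement_zero]
  obtain ⟨a, rfl⟩ := exists_zpow_of_ne_zero hω hx
  obtain ⟨b, rfl⟩ := exists_zpow_of_ne_zero hω hz
  rw [← Units.val_div_eq_div_val, div_eq_mul_inv, ← zpow_sub]
  simp only [coeff_quarticElement_zpow hF hω, sub_zero]
  exact quarticSign_mul_add m a b

theorem sum_coeff_quarticElement {m : ℕ} (hF : Fintype.card F = (4 * m + 1) ^ 2) {ω : Fˣ}
    (hω : ∀ x : Fˣ, x ∈ Subgroup.zpowers ω) : ∑ x, (quarticElement ω 0).coeff x = 0 := by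
  have h : ∑ x, (quarticElement ω 0).coeff x = ∑ x, -(quarticElement ω 0).coeff x := by
    refine Fintype.sum_equiv (Units.mulLeft (ω ^ (2 : ℤ))) _ _ fun x => ?_
    change _ = -(quarticElement ω 0).coeff (((ω ^ (2 : ℤ) : Fˣ) : F) * x)
    by_cases hx : x = 0
    · simp [hx, coeff_quarticElement_zero]
    · obtain ⟨n, rfl⟩ := exists_zpow_of_ne_zero hω hx
      rw [← Units.val_mul, ← zpow_add, coeff_quarticElement_zpow hF hω,
        coeff_quarticElement_zpow hF hω, sub_zero, sub_zero, add_comm, quarticSign_add_two, neg_neg]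
  rw [Finset.sum_neg_distrib] at h
  omega

theorem coeff_quarticElement_neg_one {m : ℕ} (hF : Fintype.card F = (4 * m + 1) ^ 2) {ω : Fˣ}
    (hω : ∀ x : Fˣ, x ∈ Subgroup.zpowers ω) : (quarticElement ω 0).coeff (-1 : F) = 1 := by
  obtain ⟨t, ht, hd⟩ := exists_neg_one_eq_zpow hF hω
  have : (4 : ℤ) ∣ t := dvd_trans ⟨2 * m + 1, by push_cast; ring⟩ hd
  rw [ht, coeff_quarticElement_zpow hF hω, sub_zero, quarticSign, if_pos (by omega)]

/-- The group ring form of `|g(χ)|² = q²` for the Gauss sum of the quartic character `χ` of a field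
with `q²` elements. -/
theorem quarticElement_sq_add_sq {m : ℕ} (hF : Fintype.card F = (4 * m + 1) ^ 2) {ω : Fˣ}
    (hω : ∀ x : Fˣ, x ∈ Subgroup.zpowers ω) :
    quarticElement ω 0 * quarticElement ω 0
      + quarticElement ω (2 * m + 1) * quarticElement ω (2 * m + 1)
      = ((4 * m + 1 : ℕ) : ℤ[F]) ^ 2 - gs (Finset.univ : Finset F) := by
  classical
  ext g
  have hc : (((4 * m + 1 : ℕ) : ℤ[F]) ^ 2).coeff g
      = if g = 0 then ((Fintype.card F : ℕ) : ℤ) else 0 := by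
    rw [hF, ← Nat.cast_pow, ← nsmul_one, AddMonoidAlgebra.coeff_smul_apply,
      AddMonoidAlgebra.one_def, AddMonoidAlgebra.coeff_single, Finsupp.single_apply]
    simp only [eq_comm (a := (0 : F))]
    split_ifs <;> simp
  rw [AddMonoidAlgebra.coeff_add, Finsupp.add_apply, coeff_mul_eq_sum, coeff_mul_eq_sum,
    ← Finset.sum_add_distrib, AddMonoidAlgebra.coeff_sub, Finsupp.sub_apply, hc, coeff_gs,
    if_pos (Finset.mem_univ g)]
  simp only [coeff_quarticElement_div hF hω]
  split_ifs with hg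
  · subst hg
    rw [← Finset.add_sum_erase _ _ (Finset.mem_univ (0 : F)),
      Finset.sum_congr rfl (g := fun _ => (1 : ℤ))]
    · rw [Finset.sum_const, Finset.card_erase_of_mem (Finset.mem_univ _), Finset.card_univ,
        nsmul_one, Nat.cast_sub Fintype.card_pos]
      simp [coeff_quarticElement_zero]
    · intro x hx
      have hx0 : x ≠ 0 := Finset.ne_of_mem_erase hx
      rw [zero_sub, div_neg, div_self hx0, coeff_quarticElement_neg_one hF hω]
  · -- `x ↦ x / (g - x)` is a bijection from `F \ {g}` onto `F \ {-1}`; at `x = g` it takes the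
    -- value `0`, where the coefficient vanishes
    have h1 := Finset.add_sum_erase Finset.univ (fun x : F => (quarticElement ω 0).coeff x)
      (Finset.mem_univ (-1))
    rw [← Finset.add_sum_erase _ _ (Finset.mem_univ g), sub_self, div_zero,
      coeff_quarticElement_zero, zero_add, Finset.sum_nbij'
        (t := Finset.univ.erase (-1 : F)) (g := fun x : F => (quarticElement ω 0).coeff x)
        (fun x => x / (g - x)) (fun t => t * g / (1 + t))]
    · simp only [coeff_quarticElement_neg_one hF hω, sum_coeff_quarticElement hF hω] at h1
      omega
    · intro x hx
      have hx' : g - x ≠ 0 := sub_ne_zero.mpr (Finset.ne_of_mem_erase hx).symm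
      refine Finset.mem_erase.mpr ⟨fun h => hg ?_, Finset.mem_univ _⟩
      rw [div_eq_iff hx'] at h
      linear_combination h
    · intro t ht
      have ht' : 1 + t ≠ 0 := fun h => (Finset.ne_of_mem_erase ht) (by linear_combination h)
      refine Finset.mem_erase.mpr ⟨fun h => hg ?_, Finset.mem_univ _⟩
      rw [div_eq_iff ht'] at h
      linear_combination -h
    · intro x hx
      have hx' : g - x ≠ 0 := sub_ne_zero.mpr (Finset.ne_of_mem_erase hx).symm
      have : 1 + x / (g - x) = g / (g - x) := by field_simp; ring
      rw [this]
      field_simp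
    · intro t ht
      have ht' : 1 + t ≠ 0 := fun h => (Finset.ne_of_mem_erase ht) (by linear_combination h)
      have : g - t * g / (1 + t) = g / (1 + t) := by field_simp; ring
      rw [this]
      field_simp
    · intro x _
      rfl

/-! ### Lines through the origin -/

theorem sub_pow_of_card_eq_sq {q : ℕ} (hq : IsPrimePow q) (hF : Fintype.card F = q ^ 2) (x y : F) :
    (x - y) ^ q = x ^ q - y ^ q := by
  obtain ⟨p, k, hp, -, rfl⟩ := hq
  have hp' : p.Prime := Nat.prime_iff.mpr hp
  obtain ⟨p', hchar⟩ := CharP.exists F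
  obtain ⟨n, hp'', hcard⟩ := FiniteField.card F p'
  have : p' ∣ p := by
    have h : p' ∣ (p ^ k) ^ 2 := by
      rw [← hF, hcard]
      exact dvd_pow_self _ n.ne_zero
    exact hp''.dvd_of_dvd_pow (hp''.dvd_of_dvd_pow h)
  rw [Nat.prime_dvd_prime_iff_eq hp'' hp'] at this
  subst this
  have : Fact p'.Prime := ⟨hp'⟩
  exact sub_pow_char_pow x y k

/-- For `v ≠ 0`, the line `{c v : c ^ q = c}` spanned by `v` over the subfield with `q` elements. -/
def lineThrough (q : ℕ) (v : F) : Finset F :=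
  open Classical in Finset.univ.filter fun x => x ^ q * v = x * v ^ q

theorem mem_lineThrough {q : ℕ} {v x : F} : x ∈ lineThrough q v ↔ x ^ q * v = x * v ^ q := by
  simp [lineThrough]

theorem zero_mem_lineThrough {q : ℕ} (hq : q ≠ 0) (v : F) : 0 ∈ lineThrough q v := by
  simp [mem_lineThrough, hq]

theorem sub_mem_lineThrough {q : ℕ} (hq : IsPrimePow q) (hF : Fintype.card F = q ^ 2) {v x y : F}
    (hx : x ∈ lineThrough q v) (hy : y ∈ lineThrough q v) : x - y ∈ lineThrough q v := by
  rw [mem_lineThrough] at *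
  rw [sub_pow_of_card_eq_sq hq hF]
  linear_combination hx - hy

theorem add_mem_lineThrough {q : ℕ} (hq : IsPrimePow q) (hF : Fintype.card F = q ^ 2) {v x y : F}
    (hx : x ∈ lineThrough q v) (hy : y ∈ lineThrough q v) : x + y ∈ lineThrough q v := by
  have h := sub_mem_lineThrough hq hF hx
    (sub_mem_lineThrough hq hF (zero_mem_lineThrough hq.ne_zero v) hy)
  rwa [zero_sub, sub_neg_eq_add] at h

theorem zpow_mem_lineThrough {m : ℕ} (hm : 0 < m) (hF : Fintype.card F = (4 * m + 1) ^ 2) {ω : Fˣ}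
    (hω : ∀ x : Fˣ, x ∈ Subgroup.zpowers ω) (n j : ℤ) :
    ((ω ^ n : Fˣ) : F) ∈ lineThrough (4 * m + 1) ((ω ^ j : Fˣ) : F)
      ↔ ((4 * m + 2 : ℕ) : ℤ) ∣ n - j := by
  have h : ∀ a b : ℤ, ((ω ^ a : Fˣ) : F) ^ (4 * m + 1) * ((ω ^ b : Fˣ) : F)
      = ((ω ^ (a * (4 * m + 1 : ℕ) + b) : Fˣ) : F) := by
    intro a b
    rw [zpow_add, zpow_mul, zpow_natCast, Units.val_mul, Units.val_pow_eq_pow_val]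
  rw [mem_lineThrough, h, mul_comm ((ω ^ n : Fˣ) : F), h, zpow_eq_zpow_iff_dvd hF hω,
    show n * (4 * m + 1 : ℕ) + j - (j * (4 * m + 1 : ℕ) + n) = ((4 * m : ℕ) : ℤ) * (n - j) by
      push_cast; ring,
    show ((2 * m * (8 * m + 4) : ℕ) : ℤ) = ((4 * m : ℕ) : ℤ) * ((4 * m + 2 : ℕ) : ℤ) by
      push_cast; ring]
  exact mul_dvd_mul_iff_left (by exact_mod_cast (by omega : 4 * m ≠ 0))

theorem card_lineThrough_eq (q : ℕ) {v : F} (hv : v ≠ 0) :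
    (lineThrough q v).card = (lineThrough q (1 : F)).card := by
  refine Finset.card_nbij' (fun x => x * v⁻¹) (fun x => x * v) ?_ ?_ ?_ ?_
  · intro x hx
    rw [Finset.mem_coe, mem_lineThrough] at *
    rw [mul_pow, inv_pow]
    field_simp
    linear_combination hx
  · intro x hx
    rw [Finset.mem_coe, mem_lineThrough] at *
    rw [mul_pow]
    linear_combination v ^ q * v * hx
  · intro x _
    simp [hv]
  · intro x _
    simp [hv]

/-- The combination of the `q + 1` lines through the origin, `q = 4 m + 1`, in which the line
through `ω ^ j` has coefficient `f j`. -/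
def lineSum (ω : Fˣ) (m : ℕ) (f : ℤ → ℤ) : ℤ[F] :=
  ∑ j ∈ Finset.range (4 * m + 2),
    ((f j : ℤ) : ℤ[F]) * gs (lineThrough (4 * m + 1) ((ω ^ (j : ℤ) : Fˣ) : F))

theorem coeff_lineSum_zpow {m : ℕ} (hm : 0 < m) (hF : Fintype.card F = (4 * m + 1) ^ 2) {ω : Fˣ}
    (hω : ∀ x : Fˣ, x ∈ Subgroup.zpowers ω) {f : ℤ → ℤ}
    (hf : ∀ a b : ℤ, ((4 * m + 2 : ℕ) : ℤ) ∣ a - b → f a = f b) (n : ℤ) :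
    (lineSum ω m f).coeff ((ω ^ n : Fˣ) : F) = f n := by
  classical
  rw [lineSum, AddMonoidAlgebra.coeff_sum, Finsupp.finsetSum_apply,
    ← sum_range_mul_ite_dvd (M := 4 * m + 2) (by omega) hf n]
  refine Finset.sum_congr rfl fun j _ => ?_
  rw [← zsmul_eq_mul, AddMonoidAlgebra.coeff_smul_apply, coeff_gs, smul_eq_mul]
  simp only [zpow_mem_lineThrough hm hF hω]

theorem coeff_lineSum_zero {m : ℕ} (ω : Fˣ) (f : ℤ → ℤ) :
    (lineSum ω m f).coeff 0
        = ∑ j ∈ Finset.range (4 * m + 2), f j := by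
  rw [lineSum, AddMonoidAlgebra.coeff_sum, Finsupp.finsetSum_apply]
  refine Finset.sum_congr rfl fun j _ => ?_
  rw [← zsmul_eq_mul, AddMonoidAlgebra.coeff_smul_apply, coeff_gs, smul_eq_mul,
    if_pos (zero_mem_lineThrough (by omega) _), mul_one]

theorem coeff_intCast {F : Type*} [Field F] (k : ℤ) (x : F) [Decidable (x = 0)] :
    ((k : ℤ[F])).coeff x = if x = 0 then k else 0 := by
  classical
  rw [← zsmul_one, AddMonoidAlgebra.coeff_smul_apply,
    AddMonoidAlgebra.one_def, AddMonoidAlgebra.coeff_single, Finsupp.single_apply]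
  simp only [eq_comm (a := (0 : F))]
  split_ifs <;> simp

/-- The `q + 1` lines through the origin cover it `q + 1` times and every other point once. -/
theorem sum_gs_lineThrough {m : ℕ} (hm : 0 < m) (hF : Fintype.card F = (4 * m + 1) ^ 2) {ω : Fˣ}
    (hω : ∀ x : Fˣ, x ∈ Subgroup.zpowers ω) :
    ∑ j ∈ Finset.range (4 * m + 2), gs (lineThrough (4 * m + 1) ((ω ^ (j : ℤ) : Fˣ) : F))
      = gs (Finset.univ : Finset F) + ((4 * m + 1 : ℤ) : ℤ[F]) := by
  classical
  have h0 := coeff_lineSum_zero (m := m) ω (fun _ => 1)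
  have h1 := coeff_lineSum_zpow hm hF hω (f := fun _ => 1) (fun _ _ _ => rfl)
  simp only [lineSum, Int.cast_one, one_mul] at h0 h1
  refine groupRing_ext hω ?_ fun n => ?_
  · rw [h0, AddMonoidAlgebra.coeff_add, Finsupp.add_apply, coeff_gs, coeff_intCast]
    simp
    ring
  · rw [h1, AddMonoidAlgebra.coeff_add, Finsupp.add_apply, coeff_gs, coeff_intCast,
      if_pos (Finset.mem_univ _), if_neg (Units.ne_zero _), add_zero]

theorem card_lineThrough {m : ℕ} (hm : 0 < m) (hF : Fintype.card F = (4 * m + 1) ^ 2) {ω : Fˣ}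
    (hω : ∀ x : Fˣ, x ∈ Subgroup.zpowers ω) {v : F} (hv : v ≠ 0) :
    (lineThrough (4 * m + 1) v).card = 4 * m + 1 := by
  have h := congrArg aug (sum_gs_lineThrough hm hF hω)
  rw [map_sum, map_add, map_intCast, aug_gs, Finset.card_univ, hF] at h
  have hc : ∀ j : ℕ, (lineThrough (4 * m + 1) ((ω ^ (j : ℤ) : Fˣ) : F)).card
      = (lineThrough (4 * m + 1) (1 : F)).card :=
    fun j => card_lineThrough_eq _ (Units.ne_zero _)
  simp only [aug_gs, hc, Finset.sum_const, Finset.card_range, nsmul_eq_mul] at h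
  rw [card_lineThrough_eq _ hv]
  generalize (lineThrough (4 * m + 1) (1 : F)).card = c at *
  push_cast at h
  have h2 : ((4 * m + 2 : ℤ)) * c = (4 * m + 2) * (4 * m + 1) := by linear_combination h
  have := mul_left_cancel₀ (by omega) h2
  exact_mod_cast this

theorem lineThrough_mul_self {m : ℕ} (hm : 0 < m) (hq : IsPrimePow (4 * m + 1))
    (hF : Fintype.card F = (4 * m + 1) ^ 2) {ω : Fˣ}
    (hω : ∀ x : Fˣ, x ∈ Subgroup.zpowers ω) {v : F} (hv : v ≠ 0) :
    gs (lineThrough (4 * m + 1) v) * gs (lineThrough (4 * m + 1) v)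
      = ((4 * m + 1 : ℤ) : ℤ[F]) * gs (lineThrough (4 * m + 1) v) := by
  rw [gs_mul_gs_of_translate (fun a ha b hb => add_mem_lineThrough hq hF ha hb)
    (fun a ha b hb => sub_mem_lineThrough hq hF hb ha), card_lineThrough hm hF hω hv]
  push_cast
  rfl

theorem lineThrough_mul_of_ne {m : ℕ} (hm : 0 < m) (hq : IsPrimePow (4 * m + 1))
    (hF : Fintype.card F = (4 * m + 1) ^ 2) {ω : Fˣ}
    (hω : ∀ x : Fˣ, x ∈ Subgroup.zpowers ω) {i j : ℤ} (hij : ¬ ((4 * m + 2 : ℕ) : ℤ) ∣ i - j) :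
    gs (lineThrough (4 * m + 1) ((ω ^ i : Fˣ) : F)) *
      gs (lineThrough (4 * m + 1) ((ω ^ j : Fˣ) : F)) = gs (Finset.univ : Finset F) := by
  refine gs_mul_gs_eq_univ ?_ ?_
  · intro a ha b hb a' ha' b' hb' e
    have h1 := sub_mem_lineThrough hq hF ha ha'
    have h2 := sub_mem_lineThrough hq hF hb' hb
    rw [show b' - b = a - a' by linear_combination -e] at h2
    by_cases h : a - a' = 0
    · exact ⟨sub_eq_zero.mp h, by linear_combination e - h⟩
    · obtain ⟨n, hn⟩ := exists_zpow_of_ne_zero hω h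
      rw [hn, zpow_mem_lineThrough hm hF hω] at h1 h2
      refine absurd ?_ hij
      have := dvd_sub h2 h1
      rwa [sub_sub_sub_cancel_left] at this
  · rw [card_lineThrough hm hF hω (Units.ne_zero _), card_lineThrough hm hF hω (Units.ne_zero _),
      hF, sq]

theorem lineSum_mul_self {m : ℕ} (hm : 0 < m) (hq : IsPrimePow (4 * m + 1))
    (hF : Fintype.card F = (4 * m + 1) ^ 2) {ω : Fˣ}
    (hω : ∀ x : Fˣ, x ∈ Subgroup.zpowers ω) (f : ℤ → ℤ) :
    (lineSum ω m f) *
    (lineSum ω m f)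
      = ((4 * m + 1 : ℤ) : ℤ[F]) * lineSum ω m (fun n => f n ^ 2)
        + (((∑ j ∈ Finset.range (4 * m + 2), f j) ^ 2
            - ∑ j ∈ Finset.range (4 * m + 2), f j ^ 2 : ℤ) : ℤ[F])
          * gs (Finset.univ : Finset F) := by
  have hprod : ∀ i ∈ Finset.range (4 * m + 2), ∀ j ∈ Finset.range (4 * m + 2),
      gs (lineThrough (4 * m + 1) ((ω ^ (i : ℤ) : Fˣ) : F)) *
        gs (lineThrough (4 * m + 1) ((ω ^ (j : ℤ) : Fˣ) : F))
      = gs (Finset.univ : Finset F) + if i = j then ((4 * m + 1 : ℤ) : ℤ[F]) *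
          gs (lineThrough (4 * m + 1) ((ω ^ (i : ℤ) : Fˣ) : F)) - gs (Finset.univ : Finset F)
        else 0 := by
    intro i hi j hj
    split_ifs with h
    · subst h
      rw [lineThrough_mul_self hm hq hF hω (Units.ne_zero _)]
      ring
    · rw [add_zero]
      refine lineThrough_mul_of_ne hm hq hF hω fun hd => h ?_
      have hi' := Finset.mem_range.mp hi
      have hj' := Finset.mem_range.mp hj
      have := Int.eq_zero_of_abs_lt_dvd hd (by rw [abs_lt]; omega)
      omega
  rw [lineSum, lineSum, Finset.sum_mul_sum]
  have hterm : ∀ i ∈ Finset.range (4 * m + 2), ∀ j ∈ Finset.range (4 * m + 2),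
      ((f i : ℤ) : ℤ[F]) * gs (lineThrough (4 * m + 1) ((ω ^ (i : ℤ) : Fˣ) : F)) *
        (((f j : ℤ) : ℤ[F]) * gs (lineThrough (4 * m + 1) ((ω ^ (j : ℤ) : Fˣ) : F)))
      = ((f i : ℤ) : ℤ[F]) * ((f j : ℤ) : ℤ[F]) * gs (Finset.univ : Finset F)
        + if i = j then ((4 * m + 1 : ℤ) : ℤ[F]) * (((f i ^ 2 : ℤ) : ℤ[F]) *
            gs (lineThrough (4 * m + 1) ((ω ^ (i : ℤ) : Fˣ) : F)))
            - ((f i ^ 2 : ℤ) : ℤ[F]) * gs (Finset.univ : Finset F) else 0 := by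
    intro i hi j hj
    rw [mul_mul_mul_comm, hprod i hi j hj]
    split_ifs with h
    · subst h
      push_cast
      ring
    · ring
  rw [Finset.sum_congr rfl fun i hi => Finset.sum_congr rfl (hterm i hi)]
  simp only [Finset.sum_add_distrib, Finset.sum_ite_eq, ← Finset.sum_mul, ← Finset.sum_mul_sum]
  rw [Finset.sum_ite_of_true (fun _ h => h), Finset.sum_sub_distrib, ← Finset.mul_sum,
    ← Finset.sum_mul]
  push_cast
  ring

/-! ### The line parts of the blocks -/

theorem aug_lineSum {m : ℕ} (hm : 0 < m) (hF : Fintype.card F = (4 * m + 1) ^ 2) {ω : Fˣ}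
    (hω : ∀ x : Fˣ, x ∈ Subgroup.zpowers ω) (f : ℤ → ℤ) :
    aug (lineSum ω m f) = (4 * m + 1) * ∑ j ∈ Finset.range (4 * m + 2), f j := by
  rw [lineSum, map_sum, Finset.mul_sum]
  refine Finset.sum_congr rfl fun j _ => ?_
  rw [map_mul, map_intCast, aug_gs, card_lineThrough hm hF hω (Units.ne_zero _)]
  push_cast
  exact mul_comm _ _

/-- The part of `2 D_i` that is constant on every line without `0`, where `D_i` is `ω ^ s` times the
base block. Subtracting `q = 4 m + 1` makes the coefficient of `0` vanish. -/
def linePart (ω : Fˣ) (m : ℕ) (s : ℤ) : ℤ[F] :=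
  lineSum ω m (fun n => lineWeight m (n - s)) - ((4 * m + 1 : ℤ) : ℤ[F])

theorem coeff_linePart_zero (ω : Fˣ) (m : ℕ) (s : ℤ) : (linePart ω m s).coeff 0 = 0 := by
  classical
  rw [linePart, AddMonoidAlgebra.coeff_sub, Finsupp.sub_apply, coeff_lineSum_zero, sum_lineWeight,
    coeff_intCast, if_pos rfl, sub_self]

theorem coeff_linePart_zpow {m : ℕ} (hm : 0 < m) (hF : Fintype.card F = (4 * m + 1) ^ 2) {ω : Fˣ}
    (hω : ∀ x : Fˣ, x ∈ Subgroup.zpowers ω) (s n : ℤ) :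
    (linePart ω m s).coeff ((ω ^ n : Fˣ) : F) = lineWeight m (n - s) := by
  classical
  rw [linePart, AddMonoidAlgebra.coeff_sub, Finsupp.sub_apply, coeff_lineSum_zpow hm hF hω,
    coeff_intCast, if_neg (Units.ne_zero _), sub_zero]
  intro a b h
  exact lineWeight_congr (by rwa [sub_sub_sub_cancel_right])

theorem linePart_congr {m : ℕ} (hm : 0 < m) (hF : Fintype.card F = (4 * m + 1) ^ 2) {ω : Fˣ}
    (hω : ∀ x : Fˣ, x ∈ Subgroup.zpowers ω) {s t : ℤ} (h : ((4 * m + 2 : ℕ) : ℤ) ∣ t - s) :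
    linePart ω m s = linePart ω m t := by
  refine groupRing_ext hω ?_ fun n => ?_
  · rw [coeff_linePart_zero, coeff_linePart_zero]
  · rw [coeff_linePart_zpow hm hF hω, coeff_linePart_zpow hm hF hω]
    exact lineWeight_congr (by rwa [sub_sub_sub_cancel_left])

/-- The products of lines reduce the left-hand side to a combination of `1`, the lines and the whole
group; by `lineWeight_shift` all lines get the same coefficient, so they too sum to the whole group
and a multiple of `1`. -/
theorem linePart_sq_add_sq {m : ℕ} (hm : 0 < m) (hq : IsPrimePow (4 * m + 1))
    (hF : Fintype.card F = (4 * m + 1) ^ 2) {ω : Fˣ} (hω : ∀ x : Fˣ, x ∈ Subgroup.zpowers ω) :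
    linePart ω m 0 * linePart ω m 0 + linePart ω m (2 * m + 1) * linePart ω m (2 * m + 1)
      = ((4 * m + 1 : ℕ) : ℤ[F]) ^ 2
        + ((2 * (4 * m + 1) ^ 2 - 4 * (4 * m + 1) + 1 : ℤ) : ℤ[F])
          * gs (Finset.univ : Finset F) := by
  have hs := lineSum_mul_self hm hq hF hω (fun n => lineWeight m (n - 0))
  have ht := lineSum_mul_self hm hq hF hω (fun n => lineWeight m (n - (2 * m + 1)))
  rw [sum_lineWeight] at hs ht
  have hw : ∀ j : ℤ, lineWeight m (j - 0) ^ 2 + lineWeight m (j - (2 * m + 1)) ^ 2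
      = 2 * (lineWeight m (j - 0) + lineWeight m (j - (2 * m + 1))) - 1 := by
    intro j
    have := lineWeight_shift m j
    rw [sub_zero]
    linear_combination this
  have hsum : ∑ j ∈ Finset.range (4 * m + 2), lineWeight m ((j : ℤ) - 0) ^ 2
      + ∑ j ∈ Finset.range (4 * m + 2), lineWeight m ((j : ℤ) - (2 * m + 1)) ^ 2
      = 3 * (4 * m + 1) - 1 := by
    rw [← Finset.sum_add_distrib, Finset.sum_congr rfl fun (j : ℕ) _ => hw j,
      Finset.sum_sub_distrib, ← Finset.mul_sum, Finset.sum_add_distrib, sum_lineWeight, sum_lineWeight]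
    simp
    ring
  have hline : lineSum ω m (fun n => lineWeight m (n - 0) ^ 2)
      + lineSum ω m (fun n => lineWeight m (n - (2 * m + 1)) ^ 2)
      = 2 * lineSum ω m (fun n => lineWeight m (n - 0))
        + 2 * lineSum ω m (fun n => lineWeight m (n - (2 * m + 1)))
        - (gs (Finset.univ : Finset F) + ((4 * m + 1 : ℤ) : ℤ[F])) := by
    rw [← sum_gs_lineThrough hm hF hω]
    simp only [lineSum]
    rw [← Finset.sum_add_distrib, Finset.mul_sum, Finset.mul_sum, ← Finset.sum_add_distrib,
      ← Finset.sum_sub_distrib]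
    refine Finset.sum_congr rfl fun j _ => ?_
    have := congrArg (fun z : ℤ => (z : ℤ[F])) (hw j)
    generalize gs (lineThrough (4 * m + 1) ((ω ^ (j : ℤ) : Fˣ) : F)) = L
    push_cast at this ⊢
    linear_combination L * this
  have hsum' := congrArg (fun z : ℤ => (z : ℤ[F])) hsum
  simp only [linePart]
  push_cast at hs ht hline hsum' ⊢
  linear_combination hs + ht + (4 * (m : ℤ[F]) + 1) * hline
    - gs (Finset.univ : Finset F) * hsum'

/-! ### The base block and its multiples -/

theorem zpow_mem_baseBlock {m : ℕ} (hF : Fintype.card F = (4 * m + 1) ^ 2) {ω : Fˣ}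
    (hω : ∀ x : Fˣ, x ∈ Subgroup.zpowers ω) (n : ℤ) :
    ((ω ^ n : Fˣ) : F) ∈ baseBlock ω m ↔ BaseIndex m n := by
  simp only [baseBlock, Finset.mem_union, Finset.mem_biUnion, Finset.mem_range, Finset.mem_Icc,
    zpow_mem_cycClass hF hω dvd_rfl, BaseIndex]

theorem zero_notMem_baseBlock (ω : Fˣ) (m : ℕ) : (0 : F) ∉ baseBlock ω m := by
  simp [baseBlock, zero_notMem_cycClass]

theorem zero_notMem_cycFamily (ω : Fˣ) (m : ℕ) (i : Fin 4) : (0 : F) ∉ cycFamily ω m i := by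
  simp only [cycFamily, Finset.mem_map, Equiv.coe_toEmbedding, not_exists, not_and]
  intro x hx h
  have : x = 0 := by
    have h' : ((ω ^ ((2 * m + 1) * (i : ℕ)) : Fˣ) : F) * x = 0 := h
    exact (mul_eq_zero.mp h').resolve_left (Units.ne_zero _)
  exact zero_notMem_baseBlock ω m (this ▸ hx)

theorem zpow_mem_cycFamily {m : ℕ} (hF : Fintype.card F = (4 * m + 1) ^ 2) {ω : Fˣ}
    (hω : ∀ x : Fˣ, x ∈ Subgroup.zpowers ω) (i : Fin 4) (n : ℤ) :
    ((ω ^ n : Fˣ) : F) ∈ cycFamily ω m i ↔ BaseIndex m (n - (2 * m + 1) * (i : ℕ)) := by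
  rw [← zpow_mem_baseBlock hF hω, cycFamily, Finset.mem_map_equiv]
  have : (Units.mulLeft (ω ^ ((2 * m + 1) * (i : ℕ)))).symm ((ω ^ n : Fˣ) : F)
      = ((ω ^ (n - (2 * m + 1) * (i : ℕ)) : Fˣ) : F) := by
    rw [Equiv.symm_apply_eq]
    change _ = ((ω ^ ((2 * m + 1) * (i : ℕ)) : Fˣ) : F) * _
    rw [← Units.val_mul, ← zpow_natCast, ← zpow_add]
    push_cast
    rw [add_sub_cancel]
  rw [this]

/-- Up to the quartic Gauss sum element, `2 D_i` is a combination of lines. -/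
theorem two_mul_gs_cycFamily {m : ℕ} (hm : 0 < m) (hF : Fintype.card F = (4 * m + 1) ^ 2) {ω : Fˣ}
    (hω : ∀ x : Fˣ, x ∈ Subgroup.zpowers ω) (i : Fin 4) :
    2 * gs (cycFamily ω m i)
      = linePart ω m ((2 * m + 1) * (i : ℕ)) - quarticElement ω ((2 * m + 1) * (i : ℕ)) := by
  classical
  have h2 : 2 * gs (cycFamily ω m i) = (2 : ℤ) • gs (cycFamily ω m i) := by
    rw [zsmul_eq_mul]
    norm_num
  rw [h2]
  refine groupRing_ext hω ?_ fun n => ?_ <;>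
    rw [AddMonoidAlgebra.coeff_smul_apply, AddMonoidAlgebra.coeff_sub, Finsupp.sub_apply, coeff_gs]
  · rw [if_neg (zero_notMem_cycFamily ω m i), coeff_linePart_zero, coeff_quarticElement_zero]
    rfl
  · rw [coeff_linePart_zpow hm hF hω, coeff_quarticElement_zpow hF hω, ← two_mul_baseIndex]
    simp only [zpow_mem_cycFamily hF hω, smul_eq_mul]

theorem exists_zpow_neg {m : ℕ} (hF : Fintype.card F = (4 * m + 1) ^ 2) {ω : Fˣ}
    (hω : ∀ x : Fˣ, x ∈ Subgroup.zpowers ω) :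
    ∃ t : ℤ, ((8 * m + 4 : ℕ) : ℤ) ∣ t ∧
      ∀ n : ℤ, -((ω ^ n : Fˣ) : F) = ((ω ^ (n + t) : Fˣ) : F) := by
  obtain ⟨t, ht, hd⟩ := exists_neg_one_eq_zpow hF hω
  refine ⟨t, hd, fun n => ?_⟩
  rw [zpow_add, Units.val_mul, ← ht, mul_neg_one]

theorem isSymmetric_cycFamily {m : ℕ} (hF : Fintype.card F = (4 * m + 1) ^ 2) {ω : Fˣ}
    (hω : ∀ x : Fˣ, x ∈ Subgroup.zpowers ω) : IsSymmetric (cycFamily ω m) := by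
  obtain ⟨t, hd, ht⟩ := exists_zpow_neg hF hω
  refine fun i => negSet_eq_self fun x hx => ?_
  obtain ⟨n, rfl⟩ := exists_zpow_of_ne_zero hω
    (fun h => zero_notMem_cycFamily ω m i (h ▸ hx) : x ≠ 0)
  rw [ht, zpow_mem_cycFamily hF hω]
  refine BaseIndex.congr ?_ ((zpow_mem_cycFamily hF hω i n).mp hx)
  rwa [sub_sub_sub_cancel_right, add_sub_cancel_left]

theorem card_cycFamily {m : ℕ} (hm : 0 < m) (hF : Fintype.card F = (4 * m + 1) ^ 2) {ω : Fˣ}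
    (hω : ∀ x : Fˣ, x ∈ Subgroup.zpowers ω) (i : Fin 4) :
    ((cycFamily ω m i).card : ℤ) = 2 * m * (4 * m + 1) := by
  -- the augmentation of the Gauss sum identity shows that quartic elements have augmentation zero
  have hY : aug (quarticElement ω 0) = 0 := by
    have h := congrArg aug (quarticElement_sq_add_sq hF hω)
    rw [map_add, map_mul, map_mul, map_sub, map_pow, map_natCast, aug_gs, Finset.card_univ, hF]
      at h
    push_cast at h
    nlinarith [mul_self_nonneg (aug (quarticElement ω 0)),
      mul_self_nonneg (aug (quarticElement ω (2 * m + 1)))]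
  have h := congrArg aug (two_mul_gs_cycFamily hm hF hω 0)
  have h0 : ((2 * m + 1) * ((0 : Fin 4) : ℕ) : ℤ) = 0 := by simp
  rw [h0, map_sub, hY, linePart, map_sub, aug_lineSum hm hF hω, sum_lineWeight, map_mul, aug_gs,
    map_intCast, map_ofNat] at h
  have hc : (cycFamily ω m i).card = (cycFamily ω m 0).card := by
    rw [cycFamily, cycFamily, Finset.card_map, Finset.card_map]
  rw [hc]
  push_cast at h
  linarith

/-! ### The family of type `H` -/

/-- The four blocks, up to the factor two, in terms of two line parts and two quartic elements. -/
theorem two_mul_gs_blocks {m : ℕ} (hm : 0 < m) (hF : Fintype.card F = (4 * m + 1) ^ 2) {ω : Fˣ}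
    (hω : ∀ x : Fˣ, x ∈ Subgroup.zpowers ω) :
    2 * gs (cycFamily ω m 0) = linePart ω m 0 - quarticElement ω 0 ∧
    2 * gs (cycFamily ω m 1) = linePart ω m (2 * m + 1) - quarticElement ω (2 * m + 1) ∧
    2 * gs (cycFamily ω m 2) = linePart ω m 0 + quarticElement ω 0 ∧
    2 * gs (cycFamily ω m 3) = linePart ω m (2 * m + 1) + quarticElement ω (2 * m + 1) := by
  have ht : ((2 * m + 1) * 2 : ℤ) % 4 = 2 := by omega
  have h2 := quarticElement_add_two hF hω 0 ht
  have h3 := quarticElement_add_two hF hω (2 * m + 1) ht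
  have p2 := linePart_congr (ω := ω) hm hF hω (s := (2 * m + 1) * 2) (t := 0)
    ⟨-1, by push_cast; ring⟩
  have p3 := linePart_congr (ω := ω) hm hF hω (s := (2 * m + 1) * 3) (t := 2 * m + 1)
    ⟨-1, by push_cast; ring⟩
  rw [zero_add] at h2
  rw [show (2 * m + 1 + (2 * m + 1) * 2 : ℤ) = (2 * m + 1) * 3 by ring] at h3
  refine ⟨?_, ?_, ?_, ?_⟩
  · simpa using two_mul_gs_cycFamily hm hF hω 0
  · simpa using two_mul_gs_cycFamily hm hF hω 1
  · have h := two_mul_gs_cycFamily hm hF hω 2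
    rw [show (((2 : Fin 4) : ℕ) : ℤ) = 2 from rfl, h2, p2, sub_neg_eq_add] at h
    exact h
  · have h := two_mul_gs_cycFamily hm hF hω 3
    rw [show (((3 : Fin 4) : ℕ) : ℤ) = 3 from rfl, h3, p3, sub_neg_eq_add] at h
    exact h

theorem sum_card_cycFamily {m : ℕ} (hm : 0 < m) (hF : Fintype.card F = (4 * m + 1) ^ 2) {ω : Fˣ}
    (hω : ∀ x : Fˣ, x ∈ Subgroup.zpowers ω) :
    ∑ i, ((cycFamily ω m i).card : ℤ) = 8 * m * (4 * m + 1) := by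
  simp only [card_cycFamily hm hF hω, Finset.sum_const, Finset.card_univ, Fintype.card_fin,
    nsmul_eq_mul]
  push_cast
  ring

theorem sum_sq_cycFamily {m : ℕ} (hm : 0 < m) (hq : IsPrimePow (4 * m + 1))
    (hF : Fintype.card F = (4 * m + 1) ^ 2) {ω : Fˣ} (hω : ∀ x : Fˣ, x ∈ Subgroup.zpowers ω) :
    ∑ i, gs (cycFamily ω m i) * gs (cycFamily ω m i)
      = (((4 * m + 1) ^ 2 : ℤ) : ℤ[F])
        + ((16 * m ^ 2 - 1 : ℤ) : ℤ[F]) * gs (Finset.univ : Finset F) := by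
  obtain ⟨h0, h1, h2, h3⟩ := two_mul_gs_blocks hm hF hω
  have hP := linePart_sq_add_sq hm hq hF hω
  have hY := quarticElement_sq_add_sq hF hω
  refine mul_left_cancel_intCast (k := 4) (by norm_num) ?_
  rw [Fin.sum_univ_four]
  generalize linePart ω m 0 = P₀ at *
  generalize linePart ω m (2 * m + 1) = P₁ at *
  generalize quarticElement ω 0 = Y₀ at *
  generalize quarticElement ω (2 * m + 1) = Y₁ at *
  push_cast at *
  linear_combination (2 * gs (cycFamily ω m 0) + P₀ - Y₀) * h0
    + (2 * gs (cycFamily ω m 1) + P₁ - Y₁) * h1 + (2 * gs (cycFamily ω m 2) + P₀ + Y₀) * h2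
    + (2 * gs (cycFamily ω m 3) + P₁ + Y₁) * h3 + 2 * hP + 2 * hY

theorem isTypeH_cycFamily {m : ℕ} (hm : 0 < m) (hq : IsPrimePow (4 * m + 1))
    (hF : Fintype.card F = (4 * m + 1) ^ 2) {ω : Fˣ} (hω : ∀ x : Fˣ, x ∈ Subgroup.zpowers ω) :
    IsTypeH (cycFamily ω m) := by
  classical
  have hpos : (0 : ℤ) ≤ 16 * m ^ 2 - 1 := by
    have : (1 : ℤ) ≤ m := by exact_mod_cast hm
    nlinarith
  obtain ⟨lam, hlam⟩ := Int.eq_ofNat_of_zero_le hpos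
  refine ⟨lam, fun g hg => ?_, ?_⟩
  · have h := diffCount_eq_coeff (isSymmetric_cycFamily (m := m) hF hω) hg
    rw [sum_sq_cycFamily hm hq hF hω, AddMonoidAlgebra.coeff_add, Finsupp.add_apply,
      coeff_intCast, if_neg hg, ← zsmul_eq_mul, AddMonoidAlgebra.coeff_smul_apply, coeff_gs,
      if_pos (Finset.mem_univ g), hlam] at h
    simpa using h
  · rw [sum_card_cycFamily hm hF hω, hF, ← hlam]
    push_cast
    ring

theorem condD3_cycFamily {m : ℕ} (hm : 0 < m) (hq : IsPrimePow (4 * m + 1))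
    (hF : Fintype.card F = (4 * m + 1) ^ 2) {ω : Fˣ} (hω : ∀ x : Fˣ, x ∈ Subgroup.zpowers ω) :
    CondD3 (cycFamily ω m) := by
  obtain ⟨h0, h1, h2, h3⟩ := two_mul_gs_blocks hm hF hω
  have hP := linePart_sq_add_sq hm hq hF hω
  have hY := quarticElement_sq_add_sq hF hω
  have hsymm := isSymmetric_cycFamily (m := m) hF hω
  rw [CondD3, hsymm 0, hsymm 1, hsymm 2, hsymm 3, sum_card_cycFamily hm hF hω, hF, zsmul_eq_mul]
  refine mul_left_cancel_intCast (k := 4) (by norm_num) ?_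
  generalize linePart ω m 0 = P₀ at *
  generalize linePart ω m (2 * m + 1) = P₁ at *
  generalize quarticElement ω 0 = Y₀ at *
  generalize quarticElement ω (2 * m + 1) = Y₁ at *
  push_cast at *
  linear_combination 4 * gs (cycFamily ω m 2) * h0 + 2 * (P₀ - Y₀) * h2
    + 4 * gs (cycFamily ω m 3) * h1 + 2 * (P₁ - Y₁) * h3 + 2 * hP - 2 * hY

theorem condD4_cycFamily {m : ℕ} (hm : 0 < m) (hF : Fintype.card F = (4 * m + 1) ^ 2) {ω : Fˣ}
    (hω : ∀ x : Fˣ, x ∈ Subgroup.zpowers ω) : CondD4 (cycFamily ω m) := by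
  have hz : ∀ i, (gs (cycFamily ω m i)).coeff 0 = 0 := fun i => by
    rw [coeff_gs, if_neg (zero_notMem_cycFamily ω m i)]
  refine ⟨fun x hx => ?_, ?_, ?_⟩
  · obtain ⟨n, rfl⟩ := exists_zpow_of_ne_zero hω hx
    obtain ⟨h0, h1, h2, h3⟩ := two_mul_gs_blocks hm hF hω
    have hsum : ∑ i, gs (cycFamily ω m i) = linePart ω m 0 + linePart ω m (2 * m + 1) := by
      refine mul_left_cancel_intCast (k := 2) (by norm_num) ?_
      rw [Fin.sum_univ_four]
      push_cast
      linear_combination h0 + h1 + h2 + h3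
    rw [hsum, AddMonoidAlgebra.coeff_add, Finsupp.add_apply, coeff_linePart_zpow hm hF hω,
      coeff_linePart_zpow hm hF hω, sub_zero]
    exact lineWeight_add_shift m n
  · rw [AddMonoidAlgebra.coeff_sum, Finsupp.finsetSum_apply]
    simp [hz]
  · rintro ⟨p, hp, -⟩
    simp [hz] at hp

/-! ### The family of type `H₄*` -/

theorem zero_notMem_quarticPair (ω : Fˣ) (a b : ℕ) : (0 : F) ∉ quarticPair ω a b := by
  simp [quarticPair, zero_notMem_cycClass]

theorem zpow_mem_quarticPair {m : ℕ} (hF : Fintype.card F = (4 * m + 1) ^ 2) {ω : Fˣ}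
    (hω : ∀ x : Fˣ, x ∈ Subgroup.zpowers ω) (a b : ℕ) (n : ℤ) :
    ((ω ^ n : Fˣ) : F) ∈ quarticPair ω a b ↔ (4 : ℤ) ∣ n - a ∨ (4 : ℤ) ∣ n - b := by
  have h4 : 4 ∣ 8 * m + 4 := ⟨2 * m + 1, by ring⟩
  simp only [quarticPair, Finset.mem_union, zpow_mem_cycClass hF hω h4, Nat.cast_ofNat]

theorem negSet_quarticPair {m : ℕ} (hF : Fintype.card F = (4 * m + 1) ^ 2) {ω : Fˣ}
    (hω : ∀ x : Fˣ, x ∈ Subgroup.zpowers ω) (a b : ℕ) :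
    negSet (quarticPair ω a b) = quarticPair ω a b := by
  obtain ⟨t, hd, ht⟩ := exists_zpow_neg hF hω
  have hd4 : (4 : ℤ) ∣ t := dvd_trans ⟨2 * m + 1, by push_cast; ring⟩ hd
  refine negSet_eq_self fun x hx => ?_
  obtain ⟨n, rfl⟩ := exists_zpow_of_ne_zero hω
    (fun h => zero_notMem_quarticPair ω a b (h ▸ hx) : x ≠ 0)
  rw [ht, zpow_mem_quarticPair hF hω]
  have := (zpow_mem_quarticPair hF hω a b n).mp hx
  omega

theorem gs_quarticPair_sub {m : ℕ} (hF : Fintype.card F = (4 * m + 1) ^ 2) {ω : Fˣ}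
    (hω : ∀ x : Fˣ, x ∈ Subgroup.zpowers ω) :
    gs (quarticPair ω 2 (2 * m + 3)) - gs (quarticPair ω 0 (2 * m + 1))
        = -quarticElement ω 0 - quarticElement ω (2 * m + 1) ∧
      gs (quarticPair ω 2 (2 * m + 1)) - gs (quarticPair ω 0 (2 * m + 3))
        = quarticElement ω (2 * m + 1) - quarticElement ω 0 := by
  constructor <;> refine groupRing_ext hω ?_ fun n => ?_
  · simp [coeff_gs, zero_notMem_quarticPair, coeff_quarticElement_zero]
  · simp only [AddMonoidAlgebra.coeff_sub, AddMonoidAlgebra.coeff_neg, Finsupp.sub_apply,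
      Finsupp.neg_apply, coeff_gs, zpow_mem_quarticPair hF hω, coeff_quarticElement_zpow hF hω,
      quarticSign]
    push_cast
    split_ifs <;> omega
  · simp [coeff_gs, zero_notMem_quarticPair, coeff_quarticElement_zero]
  · simp only [AddMonoidAlgebra.coeff_sub, Finsupp.sub_apply, coeff_gs,
      zpow_mem_quarticPair hF hω, coeff_quarticElement_zpow hF hω, quarticSign]
    push_cast
    split_ifs <;> omega

theorem starCompl_quarticPair {m : ℕ} (hF : Fintype.card F = (4 * m + 1) ^ 2) {ω : Fˣ}
    (hω : ∀ x : Fˣ, x ∈ Subgroup.zpowers ω) :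
    starCompl (quarticPair ω 2 (2 * m + 3)) = quarticPair ω 0 (2 * m + 1) ∧
      starCompl (quarticPair ω 2 (2 * m + 1)) = quarticPair ω 0 (2 * m + 3) := by
  constructor <;>
    refine finset_ext_zpow hω (by simp [starCompl]) (zero_notMem_quarticPair _ _ _) fun n => ?_ <;>
    simp only [starCompl, Finset.mem_filter, Finset.mem_univ, true_and, ne_eq, Units.ne_zero,
      not_false_eq_true, zpow_mem_quarticPair hF hω] <;>
    push_cast <;> omega

theorem isTypeHStar_quarticPair {m : ℕ} (hm : 0 < m) (hF : Fintype.card F = (4 * m + 1) ^ 2)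
    {ω : Fˣ} (hω : ∀ x : Fˣ, x ∈ Subgroup.zpowers ω) :
    IsTypeHStar ![quarticPair ω 2 (2 * m + 3), quarticPair ω 2 (2 * m + 1),
      quarticPair ω 0 (2 * m + 1), quarticPair ω 0 (2 * m + 3)] := by
  classical
  obtain ⟨hs₀, hs₁⟩ := starCompl_quarticPair hF hω
  obtain ⟨hd₀, hd₁⟩ := gs_quarticPair_sub hF hω
  have ha₀ := gs_add_gs_starCompl (zero_notMem_quarticPair ω 2 (2 * m + 3))
  have ha₁ := gs_add_gs_starCompl (zero_notMem_quarticPair ω 2 (2 * m + 1))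
  rw [hs₀] at ha₀
  rw [hs₁] at ha₁
  have hY := quarticElement_sq_add_sq hF hω
  have hN := univ_mul_univ (G := F)
  have hsymm : IsSymmetric ![quarticPair ω 2 (2 * m + 3), quarticPair ω 2 (2 * m + 1),
      quarticPair ω 0 (2 * m + 1), quarticPair ω 0 (2 * m + 3)] := by
    intro i
    fin_cases i <;> exact negSet_quarticPair hF hω _ _
  have hpos : (0 : ℤ) ≤ (4 * m + 1) ^ 2 - 3 := by
    have : (1 : ℤ) ≤ m := by exact_mod_cast hm
    nlinarith
  obtain ⟨lam, hlam⟩ := Int.eq_ofNat_of_zero_le hpos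
  refine ⟨by norm_num, lam, fun g hg => ?_, ?_⟩
  · have h := diffCount_eq_coeff hsymm hg
    have hsq : ∑ i, gs ((![quarticPair ω 2 (2 * m + 3), quarticPair ω 2 (2 * m + 1),
        quarticPair ω 0 (2 * m + 1), quarticPair ω 0 (2 * m + 3)] : Fin 4 → Finset F) i) *
          gs ((![quarticPair ω 2 (2 * m + 3), quarticPair ω 2 (2 * m + 1),
        quarticPair ω 0 (2 * m + 1), quarticPair ω 0 (2 * m + 3)] : Fin 4 → Finset F) i)
        = (((4 * m + 1) ^ 2 + 1 : ℤ) : ℤ[F])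
          + (((4 * m + 1) ^ 2 - 3 : ℤ) : ℤ[F]) * gs (Finset.univ : Finset F) := by
      refine mul_left_cancel_intCast (k := 2) (by norm_num) ?_
      rw [Fin.sum_univ_four]
      simp only [Matrix.cons_val]
      rw [hF] at hN
      generalize gs (quarticPair ω 2 (2 * m + 3)) = A at *
      generalize gs (quarticPair ω 2 (2 * m + 1)) = B at *
      generalize gs (quarticPair ω 0 (2 * m + 1)) = C at *
      generalize gs (quarticPair ω 0 (2 * m + 3)) = D at *
      generalize quarticElement ω 0 = Y₀ at *
      generalize quarticElement ω (2 * m + 1) = Y₁ at *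
      generalize gs (Finset.univ : Finset F) = N at *
      push_cast at *
      linear_combination (A + C + N - 1) * ha₀ + (B + D + N - 1) * ha₁
        + (A - C - Y₀ - Y₁) * hd₀ + (B - D + Y₁ - Y₀) * hd₁ + 2 * hY + 2 * hN
    rw [hsq, AddMonoidAlgebra.coeff_add, Finsupp.add_apply,
      coeff_intCast, if_neg hg, ← zsmul_eq_mul, AddMonoidAlgebra.coeff_smul_apply, coeff_gs,
      if_pos (Finset.mem_univ g), hlam] at h
    simpa using h
  · have hc₀ := congrArg aug ha₀
    have hc₁ := congrArg aug ha₁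
    simp only [map_add, map_sub, map_one, aug_gs, Finset.card_univ, hF] at hc₀ hc₁
    have hc₀' := congrArg (fun z : ℤ => (z : ℚ)) hc₀
    have hc₁' := congrArg (fun z : ℤ => (z : ℚ)) hc₁
    have hlam' := congrArg (fun z : ℤ => (z : ℚ)) hlam
    rw [Fin.sum_univ_four, hF]
    simp only [Matrix.cons_val]
    push_cast at *
    linear_combination hc₀' + hc₁' + hlam'

theorem cycFamily_signed_sums {m : ℕ} (hm : 0 < m) (hF : Fintype.card F = (4 * m + 1) ^ 2)
    {ω : Fˣ} (hω : ∀ x : Fˣ, x ∈ Subgroup.zpowers ω) :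
    gs (cycFamily ω m 0) + gs (cycFamily ω m 1) - gs (cycFamily ω m 2) - gs (cycFamily ω m 3)
        = gs (quarticPair ω 2 (2 * m + 3)) - gs (quarticPair ω 0 (2 * m + 1)) ∧
      gs (cycFamily ω m 0) + gs (cycFamily ω m 3) - gs (cycFamily ω m 1) - gs (cycFamily ω m 2)
        = gs (quarticPair ω 2 (2 * m + 1)) - gs (quarticPair ω 0 (2 * m + 3)) := by
  obtain ⟨h0, h1, h2, h3⟩ := two_mul_gs_blocks hm hF hω
  obtain ⟨hd₀, hd₁⟩ := gs_quarticPair_sub hF hω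
  constructor <;> refine mul_left_cancel_intCast (k := 2) (by norm_num) ?_ <;> push_cast
  · linear_combination h0 + h1 - h2 - h3 - 2 * hd₀
  · linear_combination h0 + h3 - h1 - h2 - 2 * hd₁

theorem isGoodFamily_cycFamily {m : ℕ} (hm : 0 < m) (hq : IsPrimePow (4 * m + 1))
    (hF : Fintype.card F = (4 * m + 1) ^ 2) {ω : Fˣ} (hω : ∀ x : Fˣ, x ∈ Subgroup.zpowers ω) :
    IsGoodFamily (cycFamily ω m) := by
  obtain ⟨hs₀, hs₁⟩ := starCompl_quarticPair hF hω
  obtain ⟨hd₀, hd₁⟩ := cycFamily_signed_sums hm hF hω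
  refine ⟨isSymmetric_cycFamily hF hω, isTypeH_cycFamily hm hq hF hω,
    zero_notMem_cycFamily ω m, ⟨quarticPair ω 2 (2 * m + 3), quarticPair ω 2 (2 * m + 1),
      zero_notMem_quarticPair _ _ _, zero_notMem_quarticPair _ _ _, ?_, ?_, ?_⟩,
    condD3_cycFamily hm hq hF hω, condD4_cycFamily hm hF hω, ?_⟩
  · rw [hs₀, hd₀]
  · rw [hs₁, hd₁]
  · rw [hs₀, hs₁]
    exact isTypeHStar_quarticPair hm hF hω
  · simp only [CondD5, cycFamily, Finset.card_map]

end Field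

end DiffFam

end

theorem mainTheorem7 (q m : ℕ) (hq : IsPrimePow q) (hm : q = 4 * m + 1)
    (F : Type*) [Field F] [Fintype F] (hF : Fintype.card F = q ^ 2) :
    (∃ D : Fin 4 → Finset F, DiffFam.IsGoodFamily D) ∧
    ∀ ω : Fˣ, (∀ x : Fˣ, x ∈ Subgroup.zpowers ω) →
      DiffFam.IsGoodFamily (DiffFam.cycFamily ω m) ∧
      DiffFam.gs (DiffFam.cycFamily ω m 0) + DiffFam.gs (DiffFam.cycFamily ω m 1)
          - DiffFam.gs (DiffFam.cycFamily ω m 2) - DiffFam.gs (DiffFam.cycFamily ω m 3)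
        = DiffFam.gs (DiffFam.quarticPair ω 2 (2 * m + 3))
          - DiffFam.gs (DiffFam.quarticPair ω 0 (2 * m + 1)) ∧
      DiffFam.gs (DiffFam.cycFamily ω m 0) + DiffFam.gs (DiffFam.cycFamily ω m 3)
          - DiffFam.gs (DiffFam.cycFamily ω m 1) - DiffFam.gs (DiffFam.cycFamily ω m 2)
        = DiffFam.gs (DiffFam.quarticPair ω 2 (2 * m + 1))
          - DiffFam.gs (DiffFam.quarticPair ω 0 (2 * m + 3)) ∧
      DiffFam.starCompl (DiffFam.quarticPair ω 2 (2 * m + 3))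
        = DiffFam.quarticPair ω 0 (2 * m + 1) ∧
      DiffFam.starCompl (DiffFam.quarticPair ω 2 (2 * m + 1))
        = DiffFam.quarticPair ω 0 (2 * m + 3) ∧
      DiffFam.IsTypeHStar ![DiffFam.quarticPair ω 2 (2 * m + 3),
        DiffFam.quarticPair ω 2 (2 * m + 1), DiffFam.quarticPair ω 0 (2 * m + 1),
        DiffFam.quarticPair ω 0 (2 * m + 3)] := by
  subst hm
  have hm : 0 < m := by
    have := hq.two_le
    omega
  constructor
  · obtain ⟨ω, hω⟩ := IsCyclic.exists_generator (α := Fˣ)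
    exact ⟨_, DiffFam.isGoodFamily_cycFamily hm hq hF hω⟩
  · intro ω hω
    obtain ⟨hd₀, hd₁⟩ := DiffFam.cycFamily_signed_sums hm hF hω
    obtain ⟨hs₀, hs₁⟩ := DiffFam.starCompl_quarticPair hF hω
    exact ⟨DiffFam.isGoodFamily_cycFamily hm hq hF hω, hd₀, hd₁, hs₀, hs₁,
      DiffFam.isTypeHStar_quarticPair hm hF hω⟩
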